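/- Let $q$ be a power of an odd prime, let $E=\mathbb F_{q^2}$ with the symmetric $\mathbb F_q$-bilinear form $\langle x,y\rangle_E=\tfrac12(xy^q+x^qy)$, let $O(E)$ be its isometry group, $SO(E)=\{t\in O(E):\det t=1\}$, and let $\sigma\in O(E)$ be $x\mapsto x^q$. Let $V$ be a four-dimensional symplectic vector space over $\mathbb F_q$ with complementary Lagrangian subspaces $L,L'$, and give $V\otimes E$ the symplectic form $\langle v\otimes e,v'\otimes e'\rangle=\langle v,v'\rangle\langle e,e'\rangle_E$. Let $K$ be an algebraically closed field of characteristic $0$ (for example $\overline{\mathbb Q}_\ell$), let $\psi:\mathbb F_q\to K^\times$ be a non-trivial additive character, and let $\omega$ be the Weil representation of $Sp(V\otimes E)$ attached to $\psi$, on the space of $K$-valued functions on $L'\otimes E$. Put $$W_1^-=\{f:\ \omega(1\otimes t)f=f\ \text{ for all } t\in SO(E),\quad \omega(1\otimes\sigma)f=-f\},$$ on which $g\in Sp(V)\cong Sp(4,\mathbb F_q)$ acts by $\omega(g\otimes 1)$. Then: 1. $W_1^-$ is an irreducible representation of $Sp(V)$ of dimension $\tfrac12q(q-1)^2$. 2.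 $W_1^-$ is cuspidal: for every proper parabolic subgroup of $Sp(V)$, i.e. the stabilizer of a non-empty flag of non-zero isotropic subspaces $L_1\subset\dots\subset L_k$ of $V$, with unipotent radical $U$ (the elements acting trivially on the successive quotients of $0\subset L_1\subset\dots\subset L_k\subseteq L_k^\perp\subset\dots\subset L_1^\perp\subset V$), the only vector of $W_1^-$ fixed by $U$ is $0$. 3. $W_1^-$ is degenerate, i.e. it admits no Whittaker model: if $U_0$ is the unipotent radical of a Borel subgroup of $Sp(V)$ (the stabilizer of a complete isotropic flag $\langle v_1\rangle\subset\langle v_1,v_2\rangle$, where $v_1,\dots,v_4$ is a basis of $V$ with $\langle v_1,v_4\rangle=\langle v_2,v_3\rangle=1$ and $\langle v_i,v_j\rangle=0$ for all other $i<j$), then the restriction of $W_1^-$ to $U_0$ contains no non-degenerate character, that is no one-dimensional character $U_0\to K^\times$ which is non-trivial on the root subgroups of both simple roots. 4. Even the center $U_0''$ of any such $U_0$ has no non-zero fixed vector in $W_1^-$. -/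

import Mathlib

open scoped TensorProduct

noncomputable section

namespace ThetaTen

/-- The group of linear isometries of a bilinear form: `Sp(V)` when the form is symplectic and
`O(E)` when it is a non-degenerate symmetric form. -/
def isometryGroup {F V : Type*} [Field F] [AddCommGroup V] [Module F V]
    (B : LinearMap.BilinForm F V) : Subgroup (V ≃ₗ[F] V) where
  carrier := {g | ∀ x y, B (g x) (g y) = B x y}
  mul_mem' := by
    intro a b ha hb x y
    simp only [Set.mem_ofPred_eq, LinearEquiv.mul_apply] at *
    rw [ha, hb]
  one_mem' := by
    intro x y
    simp
  inv_mem' := by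
    intro a ha x y
    have h := ha (a⁻¹ x) (a⁻¹ y)
    rw [← LinearEquiv.mul_apply, ← LinearEquiv.mul_apply, mul_inv_cancel] at h
    simpa using h.symm

/-- A symplectic form: a non-degenerate alternating bilinear form. -/
structure SymplecticForm (F V : Type*) [Field F] [AddCommGroup V] [Module F V] where
  form : LinearMap.BilinForm F V
  isAlt : form.IsAlt
  nondegenerate : form.Nondegenerate

/-- The symplectic group `Sp(V)`. -/
abbrev Sp {F V : Type*} [Field F] [AddCommGroup V] [Module F V] (B : SymplecticForm F V) :
    Subgroup (V ≃ₗ[F] V) :=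
  isometryGroup B.form

/-- A subspace on which the form vanishes identically. -/
def IsIsotropic {F V : Type*} [Field F] [AddCommGroup V] [Module F V]
    (B : SymplecticForm F V) (W : Submodule F V) : Prop :=
  ∀ x ∈ W, ∀ y ∈ W, B.form x y = 0

/-- A pair of complementary isotropic (hence Lagrangian) subspaces `L`, `L'`. -/
structure Polarization {F V : Type*} [Field F] [AddCommGroup V] [Module F V]
    (B : SymplecticForm F V) where
  L : Submodule F V
  L' : Submodule F V
  isCompl : IsCompl L L'
  isotropic : IsIsotropic B L
  isotropic' : IsIsotropic B L'

section Heisenberg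

variable {F V : Type*} [Field F] [AddCommGroup V] [Module F V]

/-- The Heisenberg group `V × F` of a symplectic space, with the multiplication
`(w, z) (w', z') = (w + w', z + z' + ⟨w, w'⟩ / 2)`. -/
@[ext]
structure HeisenbergGroup (B : SymplecticForm F V) where
  vec : V
  cent : F

variable {B : SymplecticForm F V}

instance : Mul (HeisenbergGroup B) :=
  ⟨fun a b => ⟨a.vec + b.vec, a.cent + b.cent + 2⁻¹ * B.form a.vec b.vec⟩⟩

instance : One (HeisenbergGroup B) := ⟨⟨0, 0⟩⟩

instance : Inv (HeisenbergGroup B) := ⟨fun a => ⟨-a.vec, -a.cent⟩⟩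

instance : Group (HeisenbergGroup B) :=
  Group.ofLeftAxioms
    (by
      intro a b c
      refine HeisenbergGroup.ext (add_assoc _ _ _) ?_
      change a.cent + b.cent + 2⁻¹ * B.form a.vec b.vec + c.cent
          + 2⁻¹ * B.form (a.vec + b.vec) c.vec
        = a.cent + (b.cent + c.cent + 2⁻¹ * B.form b.vec c.vec)
          + 2⁻¹ * B.form a.vec (b.vec + c.vec)
      simp only [map_add, LinearMap.add_apply]
      ring)
    (by
      intro a
      refine HeisenbergGroup.ext (zero_add _) ?_
      change 0 + a.cent + 2⁻¹ * B.form 0 a.vec = a.cent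
      simp)
    (by
      intro a
      refine HeisenbergGroup.ext (neg_add_cancel _) ?_
      change -a.cent + a.cent + 2⁻¹ * B.form (-a.vec) a.vec = 0
      simp [B.isAlt a.vec])

variable {K : Type*} [Field K]

namespace Polarization

variable (P : Polarization B)

/-- The component in `L` of a vector of `V = L ⊕ L'`. -/
def proj : V →ₗ[F] P.L := P.L.projectionOnto P.L' P.isCompl

/-- The component in `L'` of a vector of `V = L ⊕ L'`. -/
def proj' : V →ₗ[F] P.L' := P.L'.projectionOnto P.L P.isCompl.symm

lemma proj_add_proj' (w : V) : (P.proj w : V) + (P.proj' w : V) = w :=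
  Submodule.projection_add_projection_eq_self P.isCompl w

end Polarization

variable (ψ : AddChar F K) (P : Polarization B)

/-- The operator by which the element `(w, z)` of the Heisenberg group, `w = l + l'`, acts in the
Schrödinger model on the functions on `L'`:
`f ↦ (x ↦ ψ (z + ⟨x + l'/2, l⟩) f (x + l'))`. -/
def schrodingerOp (h : HeisenbergGroup B) : (P.L' → K) →ₗ[K] (P.L' → K) where
  toFun f x :=
    ψ (h.cent + B.form ((x : V) + (2⁻¹ : F) • (P.proj' h.vec : V)) (P.proj h.vec : V))
      * f (x + P.proj' h.vec)
  map_add' f g := by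
    funext x
    simp [mul_add]
  map_smul' c f := by
    funext x
    simp [mul_left_comm]

lemma SymplecticForm.swap (B : SymplecticForm F V) (x y : V) : B.form x y = -B.form y x := by
  have h := B.isAlt (x + y)
  simp only [map_add, LinearMap.add_apply, B.isAlt x, B.isAlt y] at h
  linear_combination h

lemma form_eq (P : Polarization B) (w u : V) :
    B.form w u = B.form (P.proj w : V) (P.proj' u : V) + B.form (P.proj' w : V) (P.proj u : V) := by
  conv_lhs => rw [← P.proj_add_proj' w, ← P.proj_add_proj' u]
  simp only [map_add, LinearMap.add_apply]
  rw [P.isotropic _ (P.proj w).2 _ (P.proj u).2, P.isotropic' _ (P.proj' w).2 _ (P.proj' u).2]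
  ring

/-- The Schrödinger model, on the functions on `L'`, of the irreducible representation of the
Heisenberg group with central character `ψ`. -/
def schrodingerRep (h2 : (2 : F) ≠ 0) : Representation K (HeisenbergGroup B) (P.L' → K) where
  toFun := schrodingerOp ψ P
  map_one' := by
    ext1 f
    funext x
    have e1 : (1 : HeisenbergGroup B).vec = 0 := rfl
    have e2 : (1 : HeisenbergGroup B).cent = 0 := rfl
    simp [schrodingerOp, e1, e2]
  map_mul' := by
    intro a b
    apply LinearMap.ext
    intro f
    funext x
    have e1 : (a * b).vec = a.vec + b.vec := rfl
    have e2 : (a * b).cent = a.cent + b.cent + 2⁻¹ * B.form a.vec b.vec := rfl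
    simp only [schrodingerOp, LinearMap.coe_mk, AddHom.coe_mk, Module.End.mul_apply, e1, e2,
      ← mul_assoc]
    rw [← AddChar.map_add_eq_mul, form_eq P a.vec b.vec]
    congr 2
    · simp only [map_add, LinearMap.add_apply, map_smul, Submodule.coe_add,
        LinearMap.smul_apply, smul_eq_mul]
      rw [B.swap (P.proj a.vec : V) (P.proj' b.vec : V)]
      field_simp
      ring
    · rw [map_add, add_assoc]


/-- The action `(w, z) ↦ (g w, z)` of the symplectic group on the Heisenberg group. -/
def HeisenbergGroup.act (g : Sp B) (h : HeisenbergGroup B) : HeisenbergGroup B :=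
  ⟨(g : V ≃ₗ[F] V) h.vec, h.cent⟩

/-- `T` intertwines the Schrödinger representation with its twist by `g`, that is
`T ∘ π(h) = π(g h) ∘ T` for all `h` in the Heisenberg group. -/
def Intertwines (g : Sp B) (T : (P.L' → K) →ₗ[K] (P.L' → K)) : Prop :=
  ∀ (h : HeisenbergGroup B) (f : P.L' → K),
    T (schrodingerOp ψ P h f) = schrodingerOp ψ P (h.act g) (T f)

/-- The even functions on an additive group. -/
def evenFunctions (K X : Type*) [Field K] [AddCommGroup X] : Submodule K (X → K) where
  carrier := {f | ∀ x, f (-x) = f x}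
  add_mem' := by
    intro a b ha hb x
    simp [ha x, hb x]
  zero_mem' := by
    intro x
    rfl
  smul_mem' := by
    intro c f hf x
    simp [hf x]

/-- The odd functions on an additive group. -/
def oddFunctions (K X : Type*) [Field K] [AddCommGroup X] : Submodule K (X → K) where
  carrier := {f | ∀ x, f (-x) = -f x}
  add_mem' := by
    intro a b ha hb x
    simp [ha x, hb x, add_comm]
  zero_mem' := by
    intro x
    simp
  smul_mem' := by
    intro c f hf x
    simp [hf x]

section StoneVonNeumann

lemma schrodingerOp_mul (h2 : (2 : F) ≠ 0) (a b : HeisenbergGroup B) (f : P.L' → K) :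
    schrodingerOp ψ P a (schrodingerOp ψ P b f) = schrodingerOp ψ P (a * b) f :=
  (LinearMap.congr_fun ((schrodingerRep ψ P h2).map_mul a b) f).symm

lemma schrodingerOp_one (h2 : (2 : F) ≠ 0) (f : P.L' → K) :
    schrodingerOp ψ P 1 f = f :=
  LinearMap.congr_fun ((schrodingerRep ψ P h2).map_one) f

lemma schrodingerOp_cent (w : V) (z : F) :
    schrodingerOp ψ P ⟨w, z⟩ = ψ z • schrodingerOp ψ P ⟨w, 0⟩ := by
  apply LinearMap.ext
  intro f
  funext x
  simp [schrodingerOp, AddChar.map_add_eq_mul, mul_assoc]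

lemma act_mul (g : Sp B) (a b : HeisenbergGroup B) : (a * b).act g = a.act g * b.act g := by
  refine HeisenbergGroup.ext (map_add _ _ _) ?_
  change _ + 2⁻¹ * _ = _ + 2⁻¹ * _
  congr 2
  exact (g.2 _ _).symm

lemma commutator_eq (h2 : (2 : F) ≠ 0) (u w : V) :
    (⟨u, 0⟩ * ⟨w, 0⟩ * ⟨-u, 0⟩ : HeisenbergGroup B) = ⟨w, B.form u w⟩ := by
  refine HeisenbergGroup.ext ?_ ?_
  · change u + w + -u = w
    abel
  · change 0 + 0 + 2⁻¹ * B.form u w + 0 + 2⁻¹ * B.form (u + w) (-u) = B.form u w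
    simp only [map_neg, map_add, LinearMap.add_apply, B.isAlt u]
    rw [B.swap w u]
    field_simp
    ring

/-- A nontrivial additive character is nontrivial on the values `⟨·, w⟩`, for `w ≠ 0`. -/
lemma exists_char_ne_one {ψ : AddChar F K} (hψ : ψ ≠ 1) {w : V} (hw : w ≠ 0) :
    ∃ u : V, ψ (B.form u w) ≠ 1 := by
  obtain ⟨z, hz⟩ := (AddChar.ne_one_iff).1 hψ
  have : ∃ u, B.form u w ≠ 0 := by
    by_contra! hcon
    exact hw (B.nondegenerate.2 w hcon)
  obtain ⟨u, hu⟩ := this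
  refine ⟨(z / B.form u w) • u, ?_⟩
  simpa [hu] using hz

variable {ψ}

lemma trace_schrodingerOp [Finite V] (h2 : (2 : F) ≠ 0) (hψ : ψ ≠ 1) {w : V} (hw : w ≠ 0) :
    LinearMap.trace K _ (schrodingerOp ψ P ⟨w, 0⟩) = 0 := by
  obtain ⟨u, hu⟩ := exists_char_ne_one (B := B) hψ hw
  set ρ := schrodingerRep ψ P h2 with hρ
  have key : ρ ⟨u, 0⟩ * ρ ⟨w, 0⟩ * ρ ⟨-u, 0⟩ = ψ (B.form u w) • ρ ⟨w, 0⟩ := by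
    rw [← map_mul, ← map_mul, commutator_eq h2]
    exact schrodingerOp_cent ψ P w _
  have inv : ρ ⟨-u, 0⟩ * ρ ⟨u, 0⟩ = 1 := by
    rw [← map_mul, ← map_one ρ]
    congr 1
    refine HeisenbergGroup.ext (neg_add_cancel u) ?_
    change 0 + 0 + 2⁻¹ * B.form (-u) u = 0
    simp [B.isAlt u]
  have := congrArg (LinearMap.trace K _) key
  rw [mul_assoc, LinearMap.trace_mul_comm, mul_assoc, inv, mul_one, map_smul, smul_eq_mul] at this
  have h3 : (ψ (B.form u w) - 1) * LinearMap.trace K _ (ρ ⟨w, 0⟩) = 0 := by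
    linear_combination -this
  exact (mul_eq_zero.1 h3).resolve_left (sub_ne_zero.2 hu)

/-- Averaging an operator over the Heisenberg group produces an intertwiner; some average does
not kill a given nonzero vector. -/
lemma exists_intertwines [Finite V] [CharZero K] (h2 : (2 : F) ≠ 0) (hψ : ψ ≠ 1) (g : Sp B)
    {f₀ : P.L' → K} (hf₀ : f₀ ≠ 0) :
    ∃ T : (P.L' → K) →ₗ[K] (P.L' → K), Intertwines ψ P g T ∧ T f₀ ≠ 0 := by
  classical
  have := Fintype.ofFinite V
  obtain ⟨x₀, hx₀⟩ := Function.ne_iff.1 hf₀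
  set S : Module.End K (P.L' → K) → Module.End K (P.L' → K) := fun A =>
    ∑ w : V, schrodingerOp ψ P ⟨(g : V ≃ₗ[F] V) w, 0⟩ * A * schrodingerOp ψ P ⟨-w, 0⟩ with hS
  have hint : ∀ A, Intertwines ψ P g (S A) := by
    intro A h f
    obtain ⟨u, z⟩ := h
    simp only [hS, LinearMap.sum_apply, Module.End.mul_apply, map_sum]
    refine Fintype.sum_equiv (Equiv.subRight u) _ _ ?_
    intro w
    simp only [Equiv.subRight_apply]
    rw [schrodingerOp_mul ψ P h2, schrodingerOp_mul ψ P h2]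
    have e1 : (⟨-w, 0⟩ * ⟨u, z⟩ : HeisenbergGroup B)
        = ⟨-(w - u), z - 2⁻¹ * B.form w u⟩ := by
      refine HeisenbergGroup.ext ?_ ?_
      · change -w + u = -(w - u)
        abel
      · change 0 + z + 2⁻¹ * B.form (-w) u = _
        simp
        ring
    have e2 : ((⟨u, z⟩ : HeisenbergGroup B).act g * ⟨(g : V ≃ₗ[F] V) (w - u), 0⟩)
        = ⟨(g : V ≃ₗ[F] V) w, z - 2⁻¹ * B.form w u⟩ := by
      refine HeisenbergGroup.ext ?_ ?_
      · change (g : V ≃ₗ[F] V) u + (g : V ≃ₗ[F] V) (w - u) = _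
        simp
      · change z + 0 + 2⁻¹ * B.form ((g : V ≃ₗ[F] V) u) ((g : V ≃ₗ[F] V) (w - u)) = _
        rw [g.2, map_sub, B.isAlt u, B.swap u w]
        ring
    rw [e1, e2, schrodingerOp_cent _ _ _ (z - _), schrodingerOp_cent _ _ _ (z - _)]
    simp
  by_contra! hcon
  have hz : ∀ v : P.L' → K,
      ∑ w : V, schrodingerOp ψ P ⟨-w, 0⟩ f₀ x₀ • schrodingerOp ψ P ⟨(g : V ≃ₗ[F] V) w, 0⟩ v = 0 := by
    intro v
    have h := hcon _ (hint (LinearMap.smulRight (LinearMap.proj x₀) v))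
    simp only [hS, LinearMap.sum_apply, Module.End.mul_apply, LinearMap.smulRight_apply,
      LinearMap.proj_apply, map_smul] at h
    exact h
  have hz' : ∑ w : V, schrodingerOp ψ P ⟨-w, 0⟩ f₀ x₀ •
      schrodingerOp ψ P ⟨(g : V ≃ₗ[F] V) w, 0⟩ = 0 := by
    apply LinearMap.ext
    intro v
    simpa [LinearMap.sum_apply] using hz v
  have ht := congrArg (LinearMap.trace K _) hz'
  rw [map_sum, Finset.sum_eq_single 0] at ht
  · rw [map_smul, map_zero, map_zero, neg_zero] at ht
    have e : (⟨0, 0⟩ : HeisenbergGroup B) = 1 := rfl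
    have e3 : schrodingerOp ψ P (1 : HeisenbergGroup B) = LinearMap.id :=
      LinearMap.ext (schrodingerOp_one ψ P h2)
    rw [e, e3, LinearMap.trace_id, LinearMap.id_apply, smul_eq_mul] at ht
    rcases mul_eq_zero.1 ht with h | h
    · exact hx₀ h
    · have hn : Module.finrank K (P.L' → K) ≠ 0 := by
        have := Fintype.ofFinite P.L'
        rw [Module.finrank_fintype_fun_eq_card]
        exact Fintype.card_ne_zero
      exact hn (by exact_mod_cast h)
  · intro w _ hw
    rw [map_smul, trace_schrodingerOp P h2 hψ, smul_zero]
    simpa using hw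
  · intro h
    exact absurd (Finset.mem_univ _) h

/-- Schur's lemma for the Schrödinger representation. -/
lemma exists_scalar [Finite V] (hψ : ψ ≠ 1) {T : (P.L' → K) →ₗ[K] (P.L' → K)}
    (hT : Intertwines ψ P 1 T) : ∃ c : K, ∀ f, T f = c • f := by
  classical
  have hT' : ∀ (h : HeisenbergGroup B) f,
      T (schrodingerOp ψ P h f) = schrodingerOp ψ P h (T f) := hT
  have := Fintype.ofFinite P.L'
  -- the operators attached to `L` are multiplications by characters
  have hL : ∀ (l : P.L) (f : P.L' → K) (x : P.L'),
      schrodingerOp ψ P ⟨(l : V), 0⟩ f x = ψ (B.form (x : V) (l : V)) * f x := by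
    intro l f x
    have e1 : P.proj (l : V) = l := Submodule.projectionOnto_apply_left P.isCompl l
    have e2 : P.proj' (l : V) = 0 := Submodule.projectionOnto_apply_right P.isCompl.symm l
    simp [schrodingerOp, e1, e2]
  have hL' : ∀ (y : P.L') (f : P.L' → K) (x : P.L'),
      schrodingerOp ψ P ⟨(y : V), 0⟩ f x = f (x + y) := by
    intro y f x
    have e1 : P.proj' (y : V) = y := Submodule.projectionOnto_apply_left P.isCompl.symm y
    have e2 : P.proj (y : V) = 0 := Submodule.projectionOnto_apply_right P.isCompl y
    simp [schrodingerOp, e1, e2]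
  have hsep : ∀ y : P.L', y ≠ 0 → ∃ l : P.L, ψ (B.form (y : V) (l : V)) ≠ 1 := by
    intro y hy
    have hy' : (-(y : V)) ≠ 0 := by simpa using hy
    obtain ⟨u, hu⟩ := exists_char_ne_one (B := B) hψ hy'
    refine ⟨P.proj u, ?_⟩
    rw [map_neg, ← B.swap, form_eq P] at hu
    have e1 : P.proj' (y : V) = y := Submodule.projectionOnto_apply_left P.isCompl.symm y
    have e2 : P.proj (y : V) = 0 := Submodule.projectionOnto_apply_right P.isCompl y
    simpa [e1, e2] using hu
  set c : K := T (Pi.single 0 1) 0 with hc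
  have hdelta : ∀ a : P.L', T (Pi.single a 1) = c • Pi.single a 1 := by
    have h0 : T (Pi.single 0 1) = c • Pi.single 0 1 := by
      funext y
      by_cases hy : y = 0
      · subst hy
        simp [hc]
      · obtain ⟨l, hl⟩ := hsep y hy
        have h1 : schrodingerOp ψ P ⟨(l : V), 0⟩ (Pi.single 0 1) = Pi.single 0 1 := by
          funext x
          rw [hL]
          by_cases hx : x = 0
          · subst hx
            simp
          · simp [hx]
        have h2 := congrFun (hT' ⟨(l : V), 0⟩ (Pi.single 0 1)) y
        rw [h1, hL] at h2
        have h3 : (ψ (B.form (y : V) (l : V)) - 1) * T (Pi.single 0 1) y = 0 := by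
          linear_combination -h2
        have h4 := (mul_eq_zero.1 h3).resolve_left (sub_ne_zero.2 hl)
        simp [h4, hy]
    intro a
    have h1 : (Pi.single a 1 : P.L' → K)
        = schrodingerOp ψ P ⟨((-a : P.L') : V), 0⟩ (Pi.single 0 1) := by
      funext x
      rw [hL']
      by_cases hx : x = a
      · subst hx
        simp
      · have : x + -a ≠ 0 := by
          intro h
          exact hx (by simpa [add_neg_eq_zero] using h)
        rw [Pi.single_eq_of_ne hx, Pi.single_eq_of_ne this]
    rw [h1, hT', h0, map_smul]
  refine ⟨c, fun f => ?_⟩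
  have hf : f = ∑ a, f a • (Pi.single a 1 : P.L' → K) := by
    funext x
    simp [Finset.sum_apply, Pi.single_apply]
  rw [hf, map_sum, Finset.smul_sum]
  refine Finset.sum_congr rfl fun a _ => ?_
  rw [map_smul, hdelta, smul_comm]

end StoneVonNeumann

/-- The Weil operator of `g`. By Schur's lemma the intertwiners from the Schrödinger representation
to its twist by `g` form a line, and they preserve parity. As the space of even functions on `L'`
has one dimension more than the space of odd ones, `det (T | even) / det (T | odd)` scales like `T`,
and precisely one intertwiner has the same determinant on the two spaces. -/
structure IsWeilOperator (g : Sp B) (T : (P.L' → K) ≃ₗ[K] (P.L' → K)) : Prop where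
  intertwines : Intertwines ψ P g T.toLinearMap
  normalized : ∃ (he : ∀ f ∈ evenFunctions K P.L', T.toLinearMap f ∈ evenFunctions K P.L')
    (ho : ∀ f ∈ oddFunctions K P.L', T.toLinearMap f ∈ oddFunctions K P.L'),
    LinearMap.det (T.toLinearMap.restrict he) = LinearMap.det (T.toLinearMap.restrict ho)

section WeilOperator

/-- The operator `f ↦ (x ↦ f (-x))`. -/
def parity (K X : Type*) [Field K] [AddCommGroup X] : (X → K) →ₗ[K] (X → K) :=
  LinearMap.funLeft K K (fun x : X => -x)

lemma eq_zero_of_neg_eq {X : Type*} [AddCommGroup X] [Module F X] (h2 : (2 : F) ≠ 0) (x : X)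
    (hx : -x = x) : x = 0 := by
  have h : (2 : F) • x = 0 := by
    rw [two_smul]
    nth_rewrite 1 [← hx]
    exact neg_add_cancel x
  exact (smul_eq_zero.1 h).resolve_left h2

lemma trace_parity (K : Type*) {X : Type*} [Field K] [AddCommGroup X] [Finite X]
    (hX : ∀ x : X, -x = x → x = 0) : LinearMap.trace K _ (parity K X) = 1 := by
  classical
  have := Fintype.ofFinite X
  rw [LinearMap.trace_eq_matrix_trace K (Pi.basisFun K X), Matrix.trace,
    Finset.sum_eq_single 0]
  · simp [parity, LinearMap.funLeft]
  · intro x _ hx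
    have : -x ≠ x := fun h => hx (hX x h)
    simp [parity, LinearMap.funLeft, this]
  · intro h
    exact absurd (Finset.mem_univ _) h

lemma finrank_even (K : Type*) {X : Type*} [Field K] [CharZero K] [AddCommGroup X] [Finite X]
    (hX : ∀ x : X, -x = x → x = 0) :
    Module.finrank K (evenFunctions K X) = Module.finrank K (oddFunctions K X) + 1 := by
  have he : LinearMap.IsProj (evenFunctions K X) ((2⁻¹ : K) • (LinearMap.id + parity K X)) := by
    constructor
    · intro f x
      simp [parity, LinearMap.funLeft, add_comm]
    · intro f hf
      funext x
      have := hf x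
      simp only [parity, LinearMap.funLeft, LinearMap.smul_apply, LinearMap.add_apply,
        LinearMap.id_apply, LinearMap.coe_mk, AddHom.coe_mk, Pi.smul_apply, Pi.add_apply,
        Function.comp_apply, this, smul_eq_mul]
      ring
  have ho : LinearMap.IsProj (oddFunctions K X) ((2⁻¹ : K) • (LinearMap.id - parity K X)) := by
    constructor
    · intro f x
      simp only [parity, LinearMap.funLeft, LinearMap.smul_apply, LinearMap.sub_apply,
        LinearMap.id_apply, LinearMap.coe_mk, AddHom.coe_mk, Pi.smul_apply, Pi.sub_apply,
        Function.comp_apply, smul_eq_mul, neg_neg]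
      ring
    · intro f hf
      funext x
      have := hf x
      simp only [parity, LinearMap.funLeft, LinearMap.smul_apply, LinearMap.sub_apply,
        LinearMap.id_apply, LinearMap.coe_mk, AddHom.coe_mk, Pi.smul_apply, Pi.sub_apply,
        Function.comp_apply, this, smul_eq_mul]
      ring
  have h1 := he.trace
  have h2 := ho.trace
  rw [map_smul, map_add, trace_parity K hX, smul_eq_mul] at h1
  rw [map_smul, map_sub, trace_parity K hX, smul_eq_mul] at h2
  have h3 : (Module.finrank K (evenFunctions K X) : K)
      = ((Module.finrank K (oddFunctions K X) + 1 : ℕ) : K) := by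
    push_cast
    rw [← h1, ← h2]
    ring
  exact_mod_cast h3

variable {ψ}

lemma Intertwines.comp {P : Polarization B} {g g' : Sp B} {T T' : (P.L' → K) →ₗ[K] (P.L' → K)}
    (hT : Intertwines ψ P g T) (hT' : Intertwines ψ P g' T') :
    Intertwines ψ P (g * g') (T ∘ₗ T') := by
  intro h f
  simp only [LinearMap.comp_apply]
  rw [hT' h f, hT]
  rfl

lemma Intertwines.symm {P : Polarization B} {g : Sp B} {T : (P.L' → K) ≃ₗ[K] (P.L' → K)}
    (hT : Intertwines ψ P g T.toLinearMap) : Intertwines ψ P g⁻¹ T.symm.toLinearMap := by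
  intro h f
  apply T.injective
  have h1 := hT (h.act g⁻¹) (T.symm f)
  have h2 : (h.act g⁻¹).act g = h := by
    refine HeisenbergGroup.ext ?_ rfl
    exact LinearEquiv.apply_symm_apply (g : V ≃ₗ[F] V) h.vec
  rw [h2] at h1
  simp only [LinearEquiv.coe_coe, LinearEquiv.apply_symm_apply] at h1 ⊢
  exact h1.symm

lemma Intertwines.smul {P : Polarization B} {g : Sp B} {T : (P.L' → K) →ₗ[K] (P.L' → K)}
    (hT : Intertwines ψ P g T) (c : K) : Intertwines ψ P g (c • T) := by
  intro h f
  simp [hT h f]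

lemma parity_schrodingerOp (h : HeisenbergGroup B) (f : P.L' → K) :
    parity K P.L' (schrodingerOp ψ P h f)
      = schrodingerOp ψ P ⟨-h.vec, h.cent⟩ (parity K P.L' f) := by
  funext x
  simp only [parity, LinearMap.funLeft, schrodingerOp, LinearMap.coe_mk, AddHom.coe_mk,
    Function.comp_apply, map_neg, Submodule.coe_neg, neg_add_rev, neg_neg, map_add, smul_neg,
    LinearMap.add_apply, LinearMap.neg_apply]
  congr 2
  · abel
  · abel

lemma parity_parity {X : Type*} [AddCommGroup X] (f : X → K) :
    parity K X (parity K X f) = f := by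
  funext x
  simp [parity, LinearMap.funLeft]

lemma mem_even_iff {X : Type*} [AddCommGroup X] (f : X → K) :
    f ∈ evenFunctions K X ↔ parity K X f = f :=
  ⟨fun h => funext h, fun h x => congrFun h x⟩

lemma mem_odd_iff {X : Type*} [AddCommGroup X] (f : X → K) :
    f ∈ oddFunctions K X ↔ parity K X f = -f :=
  ⟨fun h => funext h, fun h x => congrFun h x⟩

lemma parity_comm [Finite V] [CharZero K] (h2 : (2 : F) ≠ 0) (hψ : ψ ≠ 1) {g : Sp B}
    {T : (P.L' → K) ≃ₗ[K] (P.L' → K)} (hT : Intertwines ψ P g T.toLinearMap) (f : P.L' → K) :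
    parity K P.L' (T f) = T (parity K P.L' f) := by
  have hX : ∀ x : P.L', -x = x → x = 0 := eq_zero_of_neg_eq h2
  have h1 : Intertwines ψ P g (parity K P.L' ∘ₗ T.toLinearMap ∘ₗ parity K P.L') := by
    intro h f
    have h3 : (⟨-((⟨-h.vec, h.cent⟩ : HeisenbergGroup B).act g).vec,
        ((⟨-h.vec, h.cent⟩ : HeisenbergGroup B).act g).cent⟩ : HeisenbergGroup B) = h.act g := by
      refine HeisenbergGroup.ext ?_ rfl
      change -((g : V ≃ₗ[F] V) (-h.vec)) = (g : V ≃ₗ[F] V) h.vec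
      simp
    simp only [LinearMap.comp_apply]
    rw [parity_schrodingerOp, hT, parity_schrodingerOp, h3]
  have h3 := hT.symm.comp h1
  rw [inv_mul_cancel] at h3
  obtain ⟨c, hc⟩ := exists_scalar P hψ h3
  have hc' : ∀ f, parity K P.L' (T (parity K P.L' f)) = c • T f := by
    intro f
    have h := hc f
    simp only [LinearMap.comp_apply, LinearEquiv.coe_coe] at h
    rw [LinearEquiv.symm_apply_eq] at h
    rw [h, map_smul]
  have hsq : c * c = 1 := by
    have hne : T 1 ≠ 0 := by
      rw [Ne, LinearEquiv.map_eq_zero_iff]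
      exact one_ne_zero
    have h := hc' (parity K P.L' 1)
    rw [parity_parity] at h
    have h4 := congrArg (parity K P.L') h
    rw [parity_parity, map_smul, hc', smul_smul] at h4
    have h5 : (c * c - 1) • T 1 = 0 := by
      rw [sub_smul, one_smul, ← h4, sub_self]
    exact sub_eq_zero.1 ((smul_eq_zero.1 h5).resolve_right hne)
  rcases mul_self_eq_one_iff.1 hsq with h | h
  · have h4 := hc' (parity K P.L' f)
    rw [parity_parity, h, one_smul] at h4
    exact h4
  · exfalso
    have h4 : T.conj (parity K P.L') = -parity K P.L' := by
      apply LinearMap.ext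
      intro f
      have h5 := hc' (T.symm f)
      rw [h, LinearEquiv.apply_symm_apply] at h5
      have h6 := congrArg (parity K P.L') h5
      rw [parity_parity] at h6
      rw [LinearEquiv.conj_apply_apply, h6]
      simp
    have h5 := congrArg (LinearMap.trace K _) h4
    rw [LinearMap.trace_conj', map_neg, trace_parity K hX] at h5
    have h6 : (2 : K) = 0 := by linear_combination h5
    exact two_ne_zero h6

lemma det_restrict_ne_zero {W : Type*} [AddCommGroup W] [Module K W] [FiniteDimensional K W]
    (T : W ≃ₗ[K] W) (U : Submodule K W) (h : ∀ f ∈ U, T.toLinearMap f ∈ U) :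
    LinearMap.det (T.toLinearMap.restrict h) ≠ 0 := by
  have hinj : Function.Injective (T.toLinearMap.restrict h) := by
    intro a b hab
    apply Subtype.ext
    apply T.injective
    exact congrArg Subtype.val hab
  have := LinearEquiv.isUnit_det' (LinearEquiv.ofInjectiveEndo _ hinj)
  exact this.ne_zero

lemma det_restrict_smul {W : Type*} [AddCommGroup W] [Module K W]
    (T T' : W →ₗ[K] W) (U : Submodule K W) (h : ∀ f ∈ U, T f ∈ U) (h' : ∀ f ∈ U, T' f ∈ U)
    (c : K) (hc : ∀ f, T' f = c • T f) :
    LinearMap.det (T'.restrict h') = c ^ Module.finrank K U * LinearMap.det (T.restrict h) := by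
  rw [← LinearMap.det_smul]
  congr 1
  apply LinearMap.ext
  intro f
  apply Subtype.ext
  exact hc f

theorem existsUnique_isWeilOperator [Finite V] [CharZero K] (h2 : (2 : F) ≠ 0) (hψ : ψ ≠ 1)
    (g : Sp B) : ∃! T : (P.L' → K) ≃ₗ[K] (P.L' → K), IsWeilOperator ψ P g T := by
  have hrank := finrank_even K (X := P.L') (eq_zero_of_neg_eq h2)
  obtain ⟨T, hT, hT1⟩ := exists_intertwines P h2 hψ g (one_ne_zero (α := P.L' → K))
  obtain ⟨S, hS, hS1⟩ := exists_intertwines P h2 hψ g⁻¹ hT1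
  have hST := hS.comp hT
  rw [inv_mul_cancel] at hST
  obtain ⟨c, hc⟩ := exists_scalar P hψ hST
  have hc0 : c ≠ 0 := by
    rintro rfl
    exact hS1 (by simpa using hc 1)
  have hinj : Function.Injective T := by
    rw [← LinearMap.ker_eq_bot, LinearMap.ker_eq_bot']
    intro f hf
    have h := hc f
    rw [LinearMap.comp_apply, hf, map_zero] at h
    exact (smul_eq_zero.1 h.symm).resolve_left hc0
  set E := LinearEquiv.ofInjectiveEndo T hinj with hE
  have hE1 : Intertwines ψ P g E.toLinearMap := hT
  have pres : ∀ A : (P.L' → K) ≃ₗ[K] (P.L' → K), Intertwines ψ P g A.toLinearMap →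
      (∀ f ∈ evenFunctions K P.L', A.toLinearMap f ∈ evenFunctions K P.L') ∧
      (∀ f ∈ oddFunctions K P.L', A.toLinearMap f ∈ oddFunctions K P.L') := by
    intro A hA
    refine ⟨fun f hf => ?_, fun f hf => ?_⟩
    · rw [mem_even_iff] at hf ⊢
      exact (parity_comm P h2 hψ hA f).trans (congrArg A hf)
    · rw [mem_odd_iff] at hf ⊢
      refine (parity_comm P h2 hψ hA f).trans ?_
      rw [hf, map_neg]
      rfl
  obtain ⟨he, ho⟩ := pres E hE1
  have de := det_restrict_ne_zero E _ he
  have dn := det_restrict_ne_zero E _ ho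
  set a := LinearMap.det (E.toLinearMap.restrict he)
  set b := LinearMap.det (E.toLinearMap.restrict ho)
  have hs : b / a ≠ 0 := div_ne_zero dn de
  refine ⟨E.trans (LinearEquiv.smulOfNeZero K _ (b / a) hs), ?_, ?_⟩
  · have hE2 : Intertwines ψ P g (E.trans (LinearEquiv.smulOfNeZero K _ (b / a) hs)).toLinearMap :=
      hE1.smul (b / a)
    obtain ⟨he', ho'⟩ := pres _ hE2
    refine ⟨hE2, he', ho', ?_⟩
    rw [det_restrict_smul E.toLinearMap _ _ he he' (b / a) (fun f => rfl),
      det_restrict_smul E.toLinearMap _ _ ho ho' (b / a) (fun f => rfl), hrank, pow_succ]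
    change _ * a = _ * b
    field_simp
  · intro A hA
    have hA1 := hE1.symm.comp hA.intertwines
    rw [inv_mul_cancel] at hA1
    obtain ⟨d, hd⟩ := exists_scalar P hψ hA1
    have hd' : ∀ f, A f = d • E f := by
      intro f
      have h := hd f
      simp only [LinearMap.comp_apply, LinearEquiv.coe_coe] at h
      rw [LinearEquiv.symm_apply_eq, map_smul] at h
      exact h
    have hd0 : d ≠ 0 := by
      rintro rfl
      have h := hd' 1
      rw [zero_smul, LinearEquiv.map_eq_zero_iff] at h
      exact one_ne_zero h
    obtain ⟨he', ho', hn⟩ := hA.normalized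
    rw [det_restrict_smul E.toLinearMap A.toLinearMap _ he he' d hd',
      det_restrict_smul E.toLinearMap A.toLinearMap _ ho ho' d hd', hrank, pow_succ] at hn
    change _ * a = _ * b at hn
    have hda : d = b / a := by
      rw [mul_assoc] at hn
      rw [eq_div_iff de]
      exact mul_left_cancel₀ (pow_ne_zero _ hd0) hn
    apply LinearEquiv.ext
    intro f
    rw [hd', hda]
    rfl

lemma isWeilOperator_one : IsWeilOperator ψ P 1 (1 : (P.L' → K) ≃ₗ[K] (P.L' → K)) := by
  refine ⟨fun h f => rfl, fun f hf => hf, fun f hf => hf, ?_⟩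
  exact (LinearMap.det_id).trans (LinearMap.det_id).symm

lemma IsWeilOperator.mul {P : Polarization B} {g g' : Sp B}
    {T T' : (P.L' → K) ≃ₗ[K] (P.L' → K)} (hT : IsWeilOperator ψ P g T)
    (hT' : IsWeilOperator ψ P g' T') : IsWeilOperator ψ P (g * g') (T * T') := by
  obtain ⟨he, ho, hn⟩ := hT.normalized
  obtain ⟨he', ho', hn'⟩ := hT'.normalized
  refine ⟨hT.intertwines.comp hT'.intertwines, fun f hf => he _ (he' f hf),
    fun f hf => ho _ (ho' f hf), ?_⟩
  have h := congrArg₂ (· * ·) hn hn'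
  simp only [← LinearMap.det_comp] at h
  exact h

end WeilOperator

/-- The Weil representation of `Sp(V)` attached to `ψ`, on the functions on `L'`: it is characterized,
up to a twist by a one-dimensional character of `Sp(V)`, by `ω(g) π(h) ω(g)⁻¹ = π(g h)` for all `h` in
the Heisenberg group, where `π` is the Schrödinger representation (see `weilRep_intertwines`). The
group `Sp(V)` is perfect, so that there is no such twist, except if `V` is a plane over the field with
three elements. -/
def weilRep [Finite V] [CharZero K] (h2 : (2 : F) ≠ 0) {ψ : AddChar F K} (hψ : ψ ≠ 1)
    (P : Polarization B) : Representation K (Sp B) (P.L' → K) where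
  toFun g := ((existsUnique_isWeilOperator P h2 hψ g).choose : (P.L' → K) ≃ₗ[K] (P.L' → K))
  map_one' := by
    rw [← (existsUnique_isWeilOperator P h2 hψ 1).choose_spec.2 _ (isWeilOperator_one P)]
    rfl
  map_mul' g g' := by
    rw [← (existsUnique_isWeilOperator P h2 hψ (g * g')).choose_spec.2 _
      ((existsUnique_isWeilOperator P h2 hψ g).choose_spec.1.mul
        (existsUnique_isWeilOperator P h2 hψ g').choose_spec.1)]
    rfl

theorem weilRep_intertwines [Finite V] [CharZero K] (h2 : (2 : F) ≠ 0) {ψ : AddChar F K}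
    (hψ : ψ ≠ 1) (P : Polarization B) (g : Sp B) : Intertwines ψ P g (weilRep h2 hψ P g) :=
  (existsUnique_isWeilOperator P h2 hψ g).choose_spec.1.intertwines

end Heisenberg

section DualPair

variable (F E : Type*) [Field F] [Fintype F] [Field E] [Algebra F E] [FiniteDimensional F E]

/-- The conjugation `x ↦ x ^ q` of `E` over the field `F` with `q` elements. -/
def conjugation : E ≃ₗ[F] E := (FiniteField.frobeniusAlgEquivOfAlgebraic F E).toLinearEquiv

lemma conjugation_apply (x : E) : conjugation F E x = x ^ Fintype.card F := rfl

/-- The form `⟨x, y⟩ = (x y ^ q + x ^ q y) / 2 = Tr (x y ^ q) / 2` on the quadratic extension `E`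
of the field `F` with `q` elements; see `algebraMap_normForm`. -/
def normForm : LinearMap.BilinForm F E :=
  (2⁻¹ : F) • (Algebra.traceForm F E).compRight (conjugation F E).toLinearMap

variable {F E}

lemma normForm_apply (x y : E) :
    normForm F E x y = 2⁻¹ * Algebra.trace F E (x * y ^ Fintype.card F) := rfl

lemma pow_card_pow_card (hE : Module.finrank F E = 2) (x : E) :
    (x ^ Fintype.card F) ^ Fintype.card F = x := by
  have : Finite E := Module.finite_of_finite F
  have := Fintype.ofFinite E
  have h := FiniteField.pow_card x
  rw [Module.card_eq_pow_finrank (K := F) (V := E), hE, pow_two, pow_mul] at h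
  exact h

theorem algebraMap_normForm (hE : Module.finrank F E = 2) (x y : E) :
    algebraMap F E (normForm F E x y)
      = 2⁻¹ * (x * y ^ Fintype.card F + x ^ Fintype.card F * y) := by
  have : Finite E := Module.finite_of_finite F
  rw [normForm_apply, map_mul, FiniteField.algebraMap_trace_eq_sum_pow, hE,
    Finset.sum_range_succ, Finset.sum_range_one, Nat.card_eq_fintype_card, pow_zero, pow_one,
    pow_one, mul_pow, pow_card_pow_card hE, map_inv₀, map_ofNat]

lemma normForm_symm (hE : Module.finrank F E = 2) (x y : E) :
    normForm F E x y = normForm F E y x := by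
  apply (algebraMap F E).injective
  rw [algebraMap_normForm hE, algebraMap_normForm hE]
  ring

lemma normForm_nondegenerate (h2 : (2 : F) ≠ 0) (hE : Module.finrank F E = 2) :
    (normForm F E).Nondegenerate := by
  have hl : ∀ x : E, (∀ y, normForm F E x y = 0) → x = 0 := by
    intro x hx
    refine (traceForm_nondegenerate F E).1 x fun y => ?_
    have h := hx ((conjugation F E).symm y)
    rw [normForm_apply, ← conjugation_apply, LinearEquiv.apply_symm_apply] at h
    exact (mul_eq_zero.1 h).resolve_left (inv_ne_zero h2)
  refine ⟨hl, fun y hy => hl y fun x => ?_⟩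
  rw [normForm_symm hE]
  exact hy x

variable (F E) in
/-- The orthogonal group of the quadratic extension `E` with the form `normForm`. -/
abbrev OrthogonalGroup : Subgroup (E ≃ₗ[F] E) := isometryGroup (normForm F E)

/-- The conjugation, as an element of the orthogonal group. -/
def conjugationO (hE : Module.finrank F E = 2) : OrthogonalGroup F E :=
  ⟨conjugation F E, by
    intro x y
    apply (algebraMap F E).injective
    simp only [algebraMap_normForm hE, conjugation_apply, pow_card_pow_card hE]
    ring⟩

variable {V : Type*} [AddCommGroup V] [Module F V]

/-- The symplectic space `V ⊗ E`, with the form `⟨v ⊗ e, v' ⊗ e'⟩ = ⟨v, v'⟩ ⟨e, e'⟩`. -/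
def SymplecticForm.tensor (B : SymplecticForm F V) (h2 : (2 : F) ≠ 0)
    (hE : Module.finrank F E = 2) : SymplecticForm F (V ⊗[F] E) where
  form := B.form.tmul (normForm F E)
  isAlt := by
    have hskew : ∀ x y : V ⊗[F] E, (B.form.tmul (normForm F E)) x y
        = -(B.form.tmul (normForm F E)) y x := by
      intro x y
      induction x with
      | zero => simp
      | add a b ha hb => simp only [map_add, LinearMap.add_apply, ha, hb, neg_add]
      | tmul v e =>
        induction y with
        | zero => simp
        | add a b ha hb => simp only [map_add, LinearMap.add_apply, ha, hb, neg_add]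
        | tmul v' e' =>
          rw [LinearMap.BilinForm.tensorDistrib_tmul, LinearMap.BilinForm.tensorDistrib_tmul,
            B.swap v v', normForm_symm hE e e', smul_neg]
    intro x
    have h := hskew x x
    have h' : (2 : F) * (B.form.tmul (normForm F E)) x x = 0 := by linear_combination h
    exact (mul_eq_zero.1 h').resolve_left h2
  nondegenerate := by
    have hskew : ∀ x y : V ⊗[F] E, (B.form.tmul (normForm F E)) x y
        = -(B.form.tmul (normForm F E)) y x := by
      intro x y
      induction x with
      | zero => simp
      | add a b ha hb => simp only [map_add, LinearMap.add_apply, ha, hb, neg_add]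
      | tmul v e =>
        induction y with
        | zero => simp
        | add a b ha hb => simp only [map_add, LinearMap.add_apply, ha, hb, neg_add]
        | tmul v' e' =>
          rw [LinearMap.BilinForm.tensorDistrib_tmul, LinearMap.BilinForm.tensorDistrib_tmul,
            B.swap v v', normForm_symm hE e e', smul_neg]
    have hl : ∀ x : V ⊗[F] E, (∀ y, (B.form.tmul (normForm F E)) x y = 0) → x = 0 := by
      intro x hx
      have hnd := normForm_nondegenerate (E := E) h2 hE
      have b := Module.finBasis F E
      set d := LinearMap.BilinForm.dualBasis (normForm F E) hnd b with hd
      obtain ⟨c, rfl⟩ := TensorProduct.eq_repr_basis_right d x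
      suffices hc : c = 0 by simp [hc]
      ext j
      refine B.nondegenerate.1 _ fun v => ?_
      have h := hx (v ⊗ₜ b j)
      rw [Finsupp.sum, map_sum, LinearMap.sum_apply, Finset.sum_eq_single j] at h
      · rw [LinearMap.BilinForm.tensorDistrib_tmul,
          LinearMap.BilinForm.apply_dualBasis_left, if_pos rfl, one_smul] at h
        exact h
      · intro i _ hij
        rw [LinearMap.BilinForm.tensorDistrib_tmul,
          LinearMap.BilinForm.apply_dualBasis_left, if_neg (Ne.symm hij), zero_smul]
      · intro hj
        rw [Finsupp.notMem_support_iff.1 hj]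
        simp
    refine ⟨hl, fun y hy => hl y fun x => ?_⟩
    rw [hskew, hy, neg_zero]

variable (E) in
/-- The subspace `L ⊗ E` of `V ⊗ E`. -/
def tensorSubspace (L : Submodule F V) : Submodule F (V ⊗[F] E) :=
  LinearMap.range (L.subtype.rTensor E)

/-- The polarization `V ⊗ E = (L ⊗ E) ⊕ (L' ⊗ E)`. -/
def Polarization.tensor {B : SymplecticForm F V} (P : Polarization B) (h2 : (2 : F) ≠ 0)
    (hE : Module.finrank F E = 2) : Polarization (B.tensor (E := E) h2 hE) where
  L := tensorSubspace E P.L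
  L' := tensorSubspace E P.L'
  isCompl := by
    constructor
    · rw [Submodule.disjoint_def]
      rintro _ ⟨x, rfl⟩ ⟨y, hy⟩
      have h := congrArg (P.proj.rTensor E) hy
      rw [← LinearMap.comp_apply, ← LinearMap.comp_apply, ← LinearMap.rTensor_comp,
        ← LinearMap.rTensor_comp] at h
      have e1 : P.proj ∘ₗ P.L.subtype = LinearMap.id :=
        LinearMap.ext fun z => Submodule.projectionOnto_apply_left P.isCompl z
      have e2 : P.proj ∘ₗ P.L'.subtype = 0 :=
        LinearMap.ext fun z => Submodule.projectionOnto_apply_right P.isCompl z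
      rw [e1, e2, LinearMap.rTensor_zero, LinearMap.rTensor_id] at h
      have hx : x = 0 := h.symm
      rw [hx, map_zero]
    · rw [codisjoint_iff, eq_top_iff]
      rintro x -
      induction x with
      | zero => exact Submodule.zero_mem _
      | add a b ha hb => exact Submodule.add_mem _ ha hb
      | tmul v e =>
        rw [← P.proj_add_proj' v, TensorProduct.add_tmul]
        exact Submodule.add_mem_sup ⟨P.proj v ⊗ₜ e, rfl⟩ ⟨P.proj' v ⊗ₜ e, rfl⟩
  isotropic := by
    rintro _ ⟨x, rfl⟩ _ ⟨y, rfl⟩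
    induction x with
    | zero => simp
    | add a b ha hb => rw [map_add, map_add, LinearMap.add_apply, ha, hb, add_zero]
    | tmul v e =>
      induction y with
      | zero => simp
      | add a b ha hb => rw [map_add, map_add, ha, hb, add_zero]
      | tmul v' e' =>
        change normForm F E e e' • B.form (v : V) (v' : V) = 0
        rw [P.isotropic _ v.2 _ v'.2, smul_zero]
  isotropic' := by
    rintro _ ⟨x, rfl⟩ _ ⟨y, rfl⟩
    induction x with
    | zero => simp
    | add a b ha hb => rw [map_add, map_add, LinearMap.add_apply, ha, hb, add_zero]
    | tmul v e =>
      induction y with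
      | zero => simp
      | add a b ha hb => rw [map_add, map_add, ha, hb, add_zero]
      | tmul v' e' =>
        change normForm F E e e' • B.form (v : V) (v' : V) = 0
        rw [P.isotropic' _ v.2 _ v'.2, smul_zero]

/-- The natural homomorphism `Sp(V) × O(E) → Sp(V ⊗ E)`, `(g, t) ↦ g ⊗ t`. -/
def dualPair (B : SymplecticForm F V) (h2 : (2 : F) ≠ 0) (hE : Module.finrank F E = 2) :
    Sp B × OrthogonalGroup F E →* Sp (B.tensor (E := E) h2 hE) where
  toFun a := ⟨TensorProduct.congr (a.1 : V ≃ₗ[F] V) (a.2 : E ≃ₗ[F] E), by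
    intro x y
    induction x with
    | zero => simp
    | add c d hc hd => simp only [map_add, LinearMap.add_apply, hc, hd]
    | tmul v e =>
      induction y with
      | zero => simp
      | add c d hc hd => simp only [map_add, hc, hd]
      | tmul v' e' =>
        change normForm F E ((a.2 : E ≃ₗ[F] E) e) ((a.2 : E ≃ₗ[F] E) e')
            • B.form ((a.1 : V ≃ₗ[F] V) v) ((a.1 : V ≃ₗ[F] V) v')
          = normForm F E e e' • B.form v v'
        rw [a.1.2, a.2.2]⟩
  map_one' := by
    apply Subtype.ext
    apply LinearEquiv.toLinearMap_injective
    apply TensorProduct.ext'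
    intro v e
    rfl
  map_mul' a b := by
    apply Subtype.ext
    apply LinearEquiv.toLinearMap_injective
    apply TensorProduct.ext'
    intro v e
    rfl

variable {K : Type*} [Field K] [CharZero K]

/-- The restriction along `Sp(V) × O(E) → Sp(V ⊗ E)` of the Weil representation of `Sp(V ⊗ E)`
attached to `ψ`, on the functions on `L' ⊗ E`. -/
def dualPairRep [FiniteDimensional F V] (h2 : (2 : F) ≠ 0) (hE : Module.finrank F E = 2)
    {ψ : AddChar F K} (hψ : ψ ≠ 1) {B : SymplecticForm F V} (P : Polarization B) :
    Representation K (Sp B × OrthogonalGroup F E) ((P.tensor (E := E) h2 hE).L' → K) :=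
  haveI : Finite (V ⊗[F] E) := Module.finite_of_finite F
  (weilRep h2 hψ (P.tensor (E := E) h2 hE)).comp (dualPair B h2 hE)

/-- The space `W₁⁻` of the functions which are fixed by `SO(E)`, the isometries of determinant `1`,
and on which the conjugation acts by `-1`. -/
def W₁minus [FiniteDimensional F V] (h2 : (2 : F) ≠ 0) (hE : Module.finrank F E = 2)
    {ψ : AddChar F K} (hψ : ψ ≠ 1) {B : SymplecticForm F V} (P : Polarization B) :
    Submodule K ((P.tensor (E := E) h2 hE).L' → K) where
  carrier := {f | (∀ t : OrthogonalGroup F E, LinearEquiv.det (t : E ≃ₗ[F] E) = 1 →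
      dualPairRep h2 hE hψ P (1, t) f = f) ∧
    dualPairRep h2 hE hψ P (1, conjugationO hE) f = -f}
  add_mem' := by
    rintro a b ⟨ha, ha'⟩ ⟨hb, hb'⟩
    refine ⟨fun t ht => ?_, ?_⟩
    · rw [map_add, ha t ht, hb t ht]
    · rw [map_add, ha', hb', neg_add]
  zero_mem' := by
    refine ⟨fun t ht => map_zero _, ?_⟩
    rw [map_zero, neg_zero]
  smul_mem' := by
    rintro c a ⟨ha, ha'⟩
    refine ⟨fun t ht => ?_, ?_⟩
    · rw [map_smul, ha t ht]
    · rw [map_smul, ha', smul_neg]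

/-- The representation of `Sp(V)` on `W₁⁻`. -/
def W₁minusRep [FiniteDimensional F V] (h2 : (2 : F) ≠ 0) (hE : Module.finrank F E = 2)
    {ψ : AddChar F K} (hψ : ψ ≠ 1) {B : SymplecticForm F V} (P : Polarization B) :
    Representation K (Sp B) (W₁minus (E := E) h2 hE hψ P) :=
  Representation.subrepresentation
    ((dualPairRep h2 hE hψ P).comp (MonoidHom.inl (Sp B) (OrthogonalGroup F E)))
    (W₁minus (E := E) h2 hE hψ P) (by
      have hcomm : ∀ (g : Sp B) (t : OrthogonalGroup F E) (f : (P.tensor (E := E) h2 hE).L' → K),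
          dualPairRep h2 hE hψ P (1, t) (dualPairRep h2 hE hψ P (g, 1) f)
            = dualPairRep h2 hE hψ P (g, 1) (dualPairRep h2 hE hψ P (1, t) f) := by
        intro g t f
        rw [← Module.End.mul_apply, ← Module.End.mul_apply, ← map_mul, ← map_mul]
        simp
      rintro g f ⟨hf, hf'⟩
      refine ⟨fun t ht => ?_, ?_⟩
      · change dualPairRep h2 hE hψ P (1, t) (dualPairRep h2 hE hψ P (g, 1) f)
          = dualPairRep h2 hE hψ P (g, 1) f
        rw [hcomm, hf t ht]
      · change dualPairRep h2 hE hψ P (1, conjugationO hE) (dualPairRep h2 hE hψ P (g, 1) f)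
          = -dualPairRep h2 hE hψ P (g, 1) f
        rw [hcomm, hf', map_neg])

end DualPair

section Parabolic

variable {F V : Type*} [Field F] [AddCommGroup V] [Module F V]

/-- A nonempty flag of nonzero isotropic subspaces of a symplectic space. -/
structure IsotropicFlag (B : SymplecticForm F V) where
  spaces : Set (Submodule F V)
  nonempty : spaces.Nonempty
  isChain : IsChain (· ≤ ·) spaces
  ne_bot : ∀ W ∈ spaces, W ≠ ⊥
  isotropic : ∀ W ∈ spaces, IsIsotropic B W

variable {B : SymplecticForm F V}

/-- The flag `0 ⊂ L₁ ⊂ ⋯ ⊂ Lₖ ⊆ Lₖ^⊥ ⊂ ⋯ ⊂ L₁^⊥ ⊂ V` generated by a flag `L₁ ⊂ ⋯ ⊂ Lₖ` of isotropic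
subspaces. -/
def IsotropicFlag.full (𝓕 : IsotropicFlag B) : Set (Submodule F V) :=
  {⊥, ⊤} ∪ 𝓕.spaces ∪ (fun W => B.form.orthogonal W) '' 𝓕.spaces

/-- The stabilizer in `Sp(V)` of an isotropic flag. These subgroups are the proper parabolic
subgroups of `Sp(V)`. -/
def IsotropicFlag.parabolic (𝓕 : IsotropicFlag B) : Subgroup (Sp B) where
  carrier := {g | ∀ W ∈ 𝓕.full, W.map ((g : V ≃ₗ[F] V) : V →ₗ[F] V) = W}
  mul_mem' := by
    intro a b ha hb W hW
    have h : (((a * b : Sp B) : V ≃ₗ[F] V) : V →ₗ[F] V)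
        = ((a : V ≃ₗ[F] V) : V →ₗ[F] V) ∘ₗ ((b : V ≃ₗ[F] V) : V →ₗ[F] V) := rfl
    rw [h, Submodule.map_comp, hb W hW, ha W hW]
  one_mem' := by
    intro W _
    exact Submodule.map_id W
  inv_mem' := by
    intro a ha W hW
    have h : (((a⁻¹ : Sp B) : V ≃ₗ[F] V) : V →ₗ[F] V) ∘ₗ ((a : V ≃ₗ[F] V) : V →ₗ[F] V)
        = LinearMap.id := by
      apply LinearMap.ext
      intro x
      exact LinearEquiv.symm_apply_apply (a : V ≃ₗ[F] V) x
    conv_lhs => rw [← ha W hW]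
    rw [← Submodule.map_comp, h, Submodule.map_id]

/-- The unipotent radical of the parabolic subgroup stabilizing an isotropic flag: the elements of
the parabolic which act trivially on the successive quotients of the flag. For `W` in the flag, the
supremum below is the step of the flag immediately below `W`. -/
def IsotropicFlag.unipotentRadical (𝓕 : IsotropicFlag B) : Subgroup (Sp B) where
  carrier := {g | g ∈ 𝓕.parabolic ∧
    ∀ W ∈ 𝓕.full, ∀ x ∈ W, (g : V ≃ₗ[F] V) x - x ∈ sSup {W' ∈ 𝓕.full | W' < W}}
  mul_mem' := by
    rintro a b ⟨ha, ha'⟩ ⟨hb, hb'⟩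
    refine ⟨mul_mem ha hb, fun W hW x hx => ?_⟩
    have hbx : (b : V ≃ₗ[F] V) x ∈ W := by
      have h := Submodule.mem_map_of_mem (f := ((b : V ≃ₗ[F] V) : V →ₗ[F] V)) hx
      rwa [hb W hW] at h
    have h := add_mem (ha' W hW _ hbx) (hb' W hW x hx)
    rwa [sub_add_sub_cancel] at h
  one_mem' := by
    refine ⟨one_mem _, fun W _ x _ => ?_⟩
    have h : ((1 : Sp B) : V ≃ₗ[F] V) x - x = 0 := sub_self x
    rw [h]
    exact Submodule.zero_mem _
  inv_mem' := by
    rintro a ⟨ha, ha'⟩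
    refine ⟨inv_mem ha, fun W hW x hx => ?_⟩
    have hax : ((a⁻¹ : Sp B) : V ≃ₗ[F] V) x ∈ W := by
      have h := Submodule.mem_map_of_mem (f := (((a⁻¹ : Sp B) : V ≃ₗ[F] V) : V →ₗ[F] V)) hx
      rwa [(inv_mem ha : a⁻¹ ∈ 𝓕.parabolic) W hW] at h
    have h := neg_mem (ha' W hW _ hax)
    have h' : (a : V ≃ₗ[F] V) (((a⁻¹ : Sp B) : V ≃ₗ[F] V) x) = x :=
      LinearEquiv.apply_symm_apply (a : V ≃ₗ[F] V) x
    rwa [h', neg_sub] at h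

variable {K M : Type*} [Field K] [AddCommGroup M] [Module K M]

/-- A representation of `Sp(V)` is cuspidal if its restriction to the unipotent radical of any
proper parabolic subgroup does not contain the trivial representation, that is, has no nonzero
fixed vector. -/
def IsCuspidal (ρ : Representation K (Sp B) M) : Prop :=
  ∀ (𝓕 : IsotropicFlag B) (v : M), (∀ u ∈ 𝓕.unipotentRadical, ρ u v = v) → v = 0

/-- A basis `(v₁, v₂, v₃, v₄)` of a four-dimensional symplectic space in which the form has its
standard matrix. -/
structure SymplecticBasis (B : SymplecticForm F V) where
  basis : Module.Basis (Fin 4) F V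
  gram : ∀ i j, B.form (basis i) (basis j) =
    (!![0, 0, 0, 1; 0, 0, 1, 0; 0, -1, 0, 0; -1, 0, 0, 0] : Matrix (Fin 4) (Fin 4) F) i j

/-- The flag `⟨v₁⟩ ⊂ ⟨v₁, v₂⟩`, whose stabilizer is a Borel subgroup. -/
def SymplecticBasis.flag (b : SymplecticBasis B) : IsotropicFlag B where
  spaces := {F ∙ b.basis 0, Submodule.span F {b.basis 0, b.basis 1}}
  nonempty := ⟨_, Or.inl rfl⟩
  isChain := by
    have h : F ∙ b.basis 0 ≤ Submodule.span F {b.basis 0, b.basis 1} :=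
      Submodule.span_mono (by simp)
    rintro x (rfl | rfl) y (rfl | rfl) hxy
    · exact absurd rfl hxy
    · exact Or.inl h
    · exact Or.inr h
    · exact absurd rfl hxy
  ne_bot := by
    rintro W (rfl | rfl) h
    · exact b.basis.ne_zero 0 (Submodule.span_singleton_eq_bot.1 h)
    · exact b.basis.ne_zero 0 (Submodule.span_eq_bot.1 h _ (by simp))
  isotropic := by
    have h : IsIsotropic B (Submodule.span F {b.basis 0, b.basis 1}) := by
      intro x hx y hy
      obtain ⟨a, c, rfl⟩ := Submodule.mem_span_pair.1 hx
      obtain ⟨a', c', rfl⟩ := Submodule.mem_span_pair.1 hy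
      simp [b.gram]
    rintro W (rfl | rfl)
    · intro x hx y hy
      exact h x (Submodule.span_mono (by simp) hx) y (Submodule.span_mono (by simp) hy)
    · exact h

/-- The maximal unipotent subgroup `U₀`, the unipotent radical of the Borel subgroup. -/
def SymplecticBasis.U₀ (b : SymplecticBasis B) : Subgroup (Sp B) := b.flag.unipotentRadical

/-- The matrices of the root subgroup of the simple root `r₁` (the short one). -/
def rootMatrix₁ (α : F) : Matrix (Fin 4) (Fin 4) F :=
  !![1, -α, 0, 0; 0, 1, 0, 0; 0, 0, 1, α; 0, 0, 0, 1]

/-- The matrices of the root subgroup of the simple root `r₂` (the long one). -/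
def rootMatrix₂ (c : F) : Matrix (Fin 4) (Fin 4) F :=
  !![1, 0, 0, 0; 0, 1, c, 0; 0, 0, 1, 0; 0, 0, 0, 1]

/-- A one-dimensional character of `U₀` is non-degenerate if it is nontrivial on the root subgroups
of both simple roots. -/
def SymplecticBasis.IsNondegenerate (b : SymplecticBasis B) (ξ : b.U₀ →* Kˣ) : Prop :=
  (∃ (u : b.U₀) (α : F),
      LinearMap.toMatrix b.basis b.basis ((u : Sp B) : V ≃ₗ[F] V).toLinearMap = rootMatrix₁ α ∧
      ξ u ≠ 1) ∧
  (∃ (u : b.U₀) (c : F),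
      LinearMap.toMatrix b.basis b.basis ((u : Sp B) : V ≃ₗ[F] V).toLinearMap = rootMatrix₂ c ∧
      ξ u ≠ 1)

/-- A representation of the symplectic group of a four-dimensional space admits a Whittaker model if
its restriction to a maximal unipotent subgroup `U₀` contains a non-degenerate character. -/
def HasWhittakerModel (ρ : Representation K (Sp B) M) : Prop :=
  ∃ (b : SymplecticBasis B) (ξ : b.U₀ →* Kˣ), b.IsNondegenerate ξ ∧
    ∃ v : M, v ≠ 0 ∧ ∀ u : b.U₀, ρ u v = (ξ u : K) • v

/-- A representation is degenerate if it does not admit a Whittaker model. -/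
def IsDegenerate (ρ : Representation K (Sp B) M) : Prop := ¬ HasWhittakerModel ρ

end Parabolic

end ThetaTen

end

open scoped TensorProduct

noncomputable section

/-! The contraction `v ⊗ e ↦ (l ↦ ⟨v, l⟩ e)` identifies `L' ⊗ E` with `Hom (L, E)`, so `ω` acts on
functions of linear maps `y : L → E`, where `L` and `E` are both planes. In this model three
families of operators are explicit. An isometry `t` of `E` acts by `y ↦ t ∘ y`. An automorphism of
`L` acts by composition on the right, up to a scalar. The transvection with parameter `c` along `l ∈
L` multiplies `f` by `ψ (-c N (y l))`, where `N e = ⟨e, e⟩ = e ^ (q + 1)`.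

A scalar in the action of `O(E)` would change the space `W₁⁻`, and a scalar in the action of the
transvections would change their fixed vectors. The normalization of the Weil operators by
determinants on even and odd functions has to exclude both (`weilRep_apply_of_diag`,
`weilRep_apply_of_fix`). With this, `W₁⁻` is the space of functions with `f (t ∘ y) = det t · f y`
(`mem_W₁minus_iff`).

Every vector of `E` is fixed by an isometry of determinant `-1`, so such an `f` vanishes at each `y`
of rank at most one (`signFunctions_apply_eq_zero`). It lives on the isomorphisms `L ≃ E`, where
`O(E)` acts freely, and the dimension is the number of orbits, the index of `O(E)` in `GL(E)`.

Two isomorphisms are in one orbit exactly when they induce the same quadratic form on `L`. The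
characters `ψ (-c N (y l))` therefore separate the orbits, and a nonzero invariant subspace contains
a function supported on a single orbit. As `GL(L)` permutes the isomorphisms transitively, the
subspace is everything (`signFunctions_irreducible`).

The remaining assertions follow from one fact (`eq_zero_of_transvections_fix`): the transvections
along a fixed line have no nonzero fixed vector. The line may be moved into `L`. A fixed `f` is then
supported where `N (y l) = 0`, that is `y l = 0` since `N` is anisotropic, and there `f` vanishes.
Such transvections lie in every unipotent radical, are central in `U₀` for the line `⟨v₁⟩`, and are
also commutators in `U₀`, so that one-dimensional characters kill them. -/

namespace ThetaTen

/-! ### Determinants on even and on odd functions -/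

section Normalization

/-- The restrictions to the even and to the odd functions of the multiplication by an even
function with value `1` at the origin have the same determinant. -/
lemma det_even_eq_det_odd_of_mul {K X : Type*} [Field K] [AddCommGroup X] [Finite X]
    (hK : (2 : K) ≠ 0) (hX : ∀ x : X, -x = x → x = 0) {m : X → K} (h0 : m 0 = 1)
    (T : (X → K) →ₗ[K] (X → K)) (hT : ∀ f x, T f x = m x * f x)
    (he : ∀ f ∈ evenFunctions K X, T f ∈ evenFunctions K X)
    (ho : ∀ f ∈ oddFunctions K X, T f ∈ oddFunctions K X) :
    LinearMap.det (T.restrict he) = LinearMap.det (T.restrict ho) := by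
  classical
  obtain ⟨n, ⟨e⟩⟩ := Finite.exists_equiv_fin X
  -- An odd sign on `X`, which amounts to choosing one element from each pair `{x, -x}`. The choice
  -- is made by comparing the labels of `x` and `-x` in an enumeration.
  obtain ⟨s, hs0, hsn, hs2⟩ : ∃ s : X → K, s 0 = 0 ∧ (∀ x, s (-x) = -s x) ∧
      ∀ x, x ≠ 0 → s x * s x = 1 := by
    refine ⟨fun x => if e x < e (-x) then 1 else if e (-x) < e x then -1 else 0, by simp, ?_, ?_⟩
    · intro x
      simp only [neg_neg]
      rcases lt_trichotomy (e x) (e (-x)) with h | h | h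
      · simp [h, h.not_gt]
      · simp [h]
      · simp [h, h.not_gt]
    · intro x hx
      rcases lt_trichotomy (e x) (e (-x)) with h | h | h
      · simp [h]
      · exact absurd (hX x (e.injective h.symm)) hx
      · simp [h, h.not_gt]
  have odd0 : ∀ g ∈ oddFunctions K X, g 0 = 0 := by
    intro g hg
    have h := hg 0
    rw [neg_zero] at h
    have h' : (2 : K) * g 0 = 0 := by linear_combination h
    exact (mul_eq_zero.1 h').resolve_left hK
  -- An even function is its value at `0` together with an odd function, its product with `s`.
  -- Multiplication by `m` respects this splitting and acts on the first factor by `m 0 = 1`.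
  let Ψ : evenFunctions K X ≃ₗ[K] K × oddFunctions K X :=
    { toFun := fun f => (f.1 0, ⟨fun x => s x * f.1 x, fun x => by
        beta_reduce
        rw [hsn, f.2 x, neg_mul]⟩)
      invFun := fun p => ⟨fun x => s x * p.2.1 x + if x = 0 then p.1 else 0, fun x => by
        beta_reduce
        rw [hsn, p.2.2 x]
        simp⟩
      map_add' := fun f g => by
        refine Prod.ext rfl (Subtype.ext (funext fun x => ?_))
        exact mul_add _ _ _
      map_smul' := fun c f => by
        refine Prod.ext rfl (Subtype.ext (funext fun x => ?_))
        exact mul_left_comm _ _ _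
      left_inv := fun f => by
        refine Subtype.ext (funext fun x => ?_)
        by_cases hx : x = 0
        · simp [hx, hs0]
        · simp [hx, ← mul_assoc, hs2 x hx]
      right_inv := fun p => by
        refine Prod.ext (by simp [hs0]) (Subtype.ext (funext fun x => ?_))
        by_cases hx : x = 0
        · simp [hx, hs0, odd0 _ p.2.2]
        · simp [hx, ← mul_assoc, hs2 x hx] }
  have key : Ψ.conj (T.restrict he) = LinearMap.prodMap LinearMap.id (T.restrict ho) := by
    apply LinearMap.ext
    intro p
    obtain ⟨f, rfl⟩ := Ψ.surjective p
    rw [LinearEquiv.conj_apply_apply, LinearEquiv.symm_apply_apply]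
    refine Prod.ext ?_ (Subtype.ext (funext fun x => ?_))
    · change T f.1 0 = f.1 0
      rw [hT, h0, one_mul]
    · change s x * T f.1 x = T (fun x => s x * f.1 x) x
      rw [hT, hT, mul_left_comm]
  have h := congrArg LinearMap.det key
  rw [LinearEquiv.conj_apply, LinearMap.comp_assoc, LinearMap.det_conj, LinearMap.det_prodMap,
    LinearMap.det_id, one_mul] at h
  exact h

/-- A homomorphism to a commutative monoid kills `diag (t, t)` if `t` is conjugate to its inverse:
`diag (t, t)` is the square of an element which is conjugate to its inverse. -/
lemma map_diag_eq_one {F E M : Type*} [Field F] [AddCommGroup E] [Module F E] [CommMonoid M]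
    (δ : ((Fin 2 → E) ≃ₗ[F] (Fin 2 → E)) →* M) (t s : E ≃ₗ[F] E) (hts : s * t * s⁻¹ = t⁻¹) :
    δ (LinearEquiv.piCongrRight fun _ => t) = 1 := by
  have hts' : ∀ x, s (t x) = t.symm (s x) := by
    intro x
    have h := LinearEquiv.congr_fun hts (s x)
    simpa using h
  let σ : (Fin 2 → E) ≃ₗ[F] (Fin 2 → E) := LinearEquiv.funCongrLeft F E (Equiv.swap 0 1)
  let D : (Fin 2 → E) ≃ₗ[F] (Fin 2 → E) := LinearEquiv.piCongrRight ![t, 1]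
  -- Explicitly `w (x₀, x₁) = (t x₁, x₀)` and `j (x₀, x₁) = (s x₁, s x₀)`; the relation `s t = t⁻¹
  -- s` becomes `w j w = j`, which forces `δ w * δ w = 1`.
  let w := D * σ
  let j := LinearEquiv.piCongrRight (fun _ : Fin 2 => s) * σ
  have hw2 : w * w = LinearEquiv.piCongrRight fun _ => t := by
    apply LinearEquiv.ext
    intro x
    funext i
    fin_cases i <;> simp [w, D, σ, LinearEquiv.funCongrLeft, LinearMap.funLeft]
  have hjw : w * j * w = j := by
    apply LinearEquiv.ext
    intro x
    funext i
    fin_cases i <;> simp [w, j, D, σ, LinearEquiv.funCongrLeft, LinearMap.funLeft, hts']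
  have h := congrArg δ hjw
  rw [map_mul, map_mul] at h
  have hj : δ j * δ j⁻¹ = 1 := by rw [← map_mul, mul_inv_cancel, map_one]
  rw [← hw2, map_mul]
  calc δ w * δ w = δ w * δ w * (δ j * δ j⁻¹) := by rw [hj, mul_one]
    _ = δ w * δ j * δ w * δ j⁻¹ := by simp only [mul_left_comm, mul_comm]
    _ = 1 := by rw [h, hj]

/-- The determinant of the translates `f ↦ f ∘ A⁻¹` on a subspace which they preserve. -/
def translationDet {F K X : Type*} [Field F] [Field K] [AddCommGroup X] [Module F X]
    (U : Submodule K (X → K))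
    (hU : ∀ (A : X ≃ₗ[F] X), ∀ f ∈ U, LinearMap.funLeft K K A.symm f ∈ U) :
    (X ≃ₗ[F] X) →* K where
  toFun A := LinearMap.det ((LinearMap.funLeft K K A.symm).restrict (hU A))
  map_one' := LinearMap.det_id
  map_mul' A A' := by
    rw [← LinearMap.det_comp]
    rfl

/-- Each of the two determinants is a homomorphism from `GL(X)` to the commutative monoid `K`, so
both are `1` at an automorphism of the form `diag (t, t)`. -/
lemma det_even_eq_det_odd_of_diag {F E K X : Type*} [Field F] [Field K] [AddCommGroup E]
    [Module F E] [AddCommGroup X] [Module F X] (e : X ≃ₗ[F] (Fin 2 → E)) (t s : E ≃ₗ[F] E)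
    (hts : s * t * s⁻¹ = t⁻¹) {A : X ≃ₗ[F] X} (hA : ∀ x i, e (A x) i = t (e x i))
    (he : ∀ f ∈ evenFunctions K X, LinearMap.funLeft K K A.symm f ∈ evenFunctions K X)
    (ho : ∀ f ∈ oddFunctions K X, LinearMap.funLeft K K A.symm f ∈ oddFunctions K X) :
    LinearMap.det ((LinearMap.funLeft K K A.symm).restrict he)
      = LinearMap.det ((LinearMap.funLeft K K A.symm).restrict ho) := by
  let τ : ((Fin 2 → E) ≃ₗ[F] (Fin 2 → E)) →* (X ≃ₗ[F] X) :=
    { toFun := fun a => (e.trans a).trans e.symm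
      map_one' := by
        apply LinearEquiv.ext
        intro x
        simp
      map_mul' := fun a b => by
        apply LinearEquiv.ext
        intro x
        simp }
  have hA' : A = τ (LinearEquiv.piCongrRight fun _ => t) := by
    apply LinearEquiv.ext
    intro x
    apply e.injective
    funext i
    simp [τ, hA]
  have h1 : ∀ (U : Submodule K (X → K))
      (hU : ∀ (A : X ≃ₗ[F] X), ∀ f ∈ U, LinearMap.funLeft K K A.symm f ∈ U),
      translationDet U hU A = 1 := by
    intro U hU
    rw [hA']
    exact map_diag_eq_one ((translationDet U hU).comp τ) t s hts
  have h2 := h1 (evenFunctions K X) (fun A f hf x => by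
    simp only [LinearMap.funLeft_apply, map_neg]
    exact hf _)
  have h3 := h1 (oddFunctions K X) (fun A f hf x => by
    simp only [LinearMap.funLeft_apply, map_neg]
    exact hf _)
  exact h2.trans h3.symm

end Normalization

/-! ### Explicit Weil operators on the stabilizer of `L` -/

section WeilFormulas

variable {F V K : Type*} [Field F] [AddCommGroup V] [Module F V] [Field K]
  {B : SymplecticForm F V} {ψ : AddChar F K}

/-- The translation by an element of the stabilizer of `L` and `L'` is an intertwiner. -/
lemma intertwines_funLeft (P : Polarization B) {g : Sp B}
    (hL : ∀ x ∈ P.L, (g : V ≃ₗ[F] V) x ∈ P.L) (A : P.L' ≃ₗ[F] P.L')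
    (hA : ∀ x : P.L', (A x : V) = (g : V ≃ₗ[F] V) x) :
    Intertwines ψ P g (LinearMap.funLeft K K A.symm) := by
  intro h f
  funext x
  obtain ⟨x, rfl⟩ := A.surjective x
  simp only [LinearMap.funLeft_apply, schrodingerOp, LinearMap.coe_mk, AddHom.coe_mk,
    LinearEquiv.symm_apply_apply]
  set a := P.proj h.vec
  set b := P.proj' h.vec
  have hn : (g : V ≃ₗ[F] V) h.vec = (g : V ≃ₗ[F] V) a + A b := by
    conv_lhs => rw [← P.proj_add_proj' h.vec, map_add, ← hA]
  have e1 : (P.proj (h.act g).vec : V) = (g : V ≃ₗ[F] V) a := by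
    change (P.proj ((g : V ≃ₗ[F] V) h.vec) : V) = _
    have e : P.proj ((g : V ≃ₗ[F] V) a) = ⟨_, hL a a.2⟩ :=
      Submodule.projectionOnto_apply_left P.isCompl ⟨_, hL a a.2⟩
    have e' : P.proj (A b : V) = 0 := Submodule.projectionOnto_apply_right P.isCompl (A b)
    rw [hn, map_add, e, e', add_zero]
  have e2 : P.proj' (h.act g).vec = A b := by
    change P.proj' ((g : V ≃ₗ[F] V) h.vec) = _
    have e : P.proj' ((g : V ≃ₗ[F] V) a) = 0 :=
      Submodule.projectionOnto_apply_right P.isCompl.symm ⟨_, hL a a.2⟩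
    have e' : P.proj' (A b : V) = A b := Submodule.projectionOnto_apply_left P.isCompl.symm (A b)
    rw [hn, map_add, e, e', zero_add]
  have e3 : (h.act g).cent = h.cent := rfl
  rw [e1, e2, e3, ← map_add, LinearEquiv.symm_apply_apply, hA, hA, ← map_smul, ← map_add, g.2]

variable [CharZero K] [Finite V]

lemma weilRep_eq_of_isWeilOperator (h2 : (2 : F) ≠ 0) (hψ : ψ ≠ 1) (P : Polarization B) {g : Sp B}
    {T : (P.L' → K) ≃ₗ[K] (P.L' → K)} (hT : IsWeilOperator ψ P g T) :
    weilRep h2 hψ P g = T.toLinearMap := by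
  rw [(existsUnique_isWeilOperator P h2 hψ g).choose_spec.2 T hT]
  rfl

/-- The Weil operators are multiples of any other intertwiner. -/
lemma exists_weilRep_eq_smul (h2 : (2 : F) ≠ 0) (hψ : ψ ≠ 1) (P : Polarization B) {g : Sp B}
    {T : (P.L' → K) →ₗ[K] (P.L' → K)} (hT : Intertwines ψ P g T) (hT0 : T ≠ 0) :
    ∃ c : K, c ≠ 0 ∧ ∀ f, weilRep h2 hψ P g f = c • T f := by
  have h1 := (weilRep_intertwines h2 hψ P g⁻¹).comp hT
  rw [inv_mul_cancel] at h1
  obtain ⟨c, hc⟩ := exists_scalar P hψ h1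
  have hc' : ∀ f, T f = c • weilRep h2 hψ P g f := by
    intro f
    rw [← map_smul, ← hc, LinearMap.comp_apply, ← Module.End.mul_apply, ← map_mul, mul_inv_cancel,
      map_one]
    rfl
  have hc0 : c ≠ 0 := by
    rintro rfl
    exact hT0 (LinearMap.ext fun f => by simpa using hc' f)
  refine ⟨c⁻¹, inv_ne_zero hc0, fun f => ?_⟩
  rw [hc', smul_smul, inv_mul_cancel₀ hc0, one_smul]

/-- The Weil representation on the unipotent radical of the stabilizer of `L`. -/
lemma weilRep_apply_of_fix (h2 : (2 : F) ≠ 0) (hψ : ψ ≠ 1) (P : Polarization B) {g : Sp B}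
    (hL : ∀ x ∈ P.L, (g : V ≃ₗ[F] V) x = x) (hL' : ∀ x ∈ P.L', (g : V ≃ₗ[F] V) x - x ∈ P.L)
    (f : P.L' → K) (x : P.L') :
    weilRep h2 hψ P g f x = ψ (-2⁻¹ * B.form (x : V) ((g : V ≃ₗ[F] V) x)) * f x := by
  set m : P.L' → K := fun x => ψ (-2⁻¹ * B.form (x : V) ((g : V ≃ₗ[F] V) x)) with hm
  have hm0 : ∀ x, m x ≠ 0 := fun x => (ψ.val_isUnit _).ne_zero
  have hmn : ∀ x, m (-x) = m x := by
    intro x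
    simp [hm]
  let T : (P.L' → K) ≃ₗ[K] (P.L' → K) :=
    LinearEquiv.piCongrRight fun x => LinearEquiv.smulOfNeZero K K (m x) (hm0 x)
  have hT : ∀ f x, T f x = m x * f x := fun f x => rfl
  have hW : IsWeilOperator ψ P g T := by
    refine ⟨?_, ?_⟩
    · intro h f
      funext x
      change m x * (_ * _) = _ * (m _ * f _)
      set a := P.proj h.vec
      set b := P.proj' h.vec
      have hn : (g : V ≃ₗ[F] V) h.vec = ((a : V) + ((g : V ≃ₗ[F] V) b - b)) + b := by
        conv_lhs => rw [← P.proj_add_proj' h.vec, map_add, hL _ (P.proj h.vec).2]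
        abel
      have hna : (a : V) + ((g : V ≃ₗ[F] V) b - b) ∈ P.L := add_mem a.2 (hL' b b.2)
      have e1 : (P.proj (h.act g).vec : V) = (a : V) + ((g : V ≃ₗ[F] V) b - b) := by
        change (P.proj ((g : V ≃ₗ[F] V) h.vec) : V) = _
        have e : P.proj ((a : V) + ((g : V ≃ₗ[F] V) b - b)) = ⟨_, hna⟩ :=
          Submodule.projectionOnto_apply_left P.isCompl ⟨_, hna⟩
        have e' : P.proj (b : V) = 0 := Submodule.projectionOnto_apply_right P.isCompl b
        rw [hn, map_add, e, e', add_zero]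
      have e2 : P.proj' (h.act g).vec = b := by
        change P.proj' ((g : V ≃ₗ[F] V) h.vec) = _
        have e : P.proj' ((a : V) + ((g : V ≃ₗ[F] V) b - b)) = 0 :=
          Submodule.projectionOnto_apply_right P.isCompl.symm ⟨_, hna⟩
        have e' : P.proj' (b : V) = b := Submodule.projectionOnto_apply_left P.isCompl.symm b
        rw [hn, map_add, e, e', zero_add]
      rw [e1, e2]
      have e3 : (h.act g).cent = h.cent := rfl
      rw [e3, ← mul_assoc, ← mul_assoc, hm]
      simp only [← AddChar.map_add_eq_mul]
      congr 2
      -- The form `(x, b) ↦ ⟨x, g b⟩` on `L'` is symmetric: expand `⟨g x - x, g b - b⟩ = 0`, which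
      -- holds because both vectors lie in `L`. Hence `-⟨x, g x⟩ / 2` is a quadratic form on `L'`,
      -- with polarization `-⟨x, g b⟩`.
      have i1 : B.form (x : V) ((g : V ≃ₗ[F] V) b) = B.form (b : V) ((g : V ≃ₗ[F] V) x) := by
        have h1 := g.2 x b
        have h2 := P.isotropic _ (hL' x x.2) _ (hL' b b.2)
        have h3 := P.isotropic' _ x.2 _ b.2
        simp only [map_sub, LinearMap.sub_apply, h1, h3] at h2
        rw [B.swap (b : V)]
        linear_combination -h2
      have i2 := P.isotropic' _ x.2 _ b.2
      have i3 := B.isAlt (b : V)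
      simp only [Submodule.coe_add, map_add, map_sub, LinearMap.add_apply, map_smul,
        LinearMap.smul_apply, smul_eq_mul, i2, i3, i1]
      field_simp
      ring
    · have he : ∀ f ∈ evenFunctions K P.L', T.toLinearMap f ∈ evenFunctions K P.L' := by
        intro f hf x
        change m (-x) * f (-x) = m x * f x
        rw [hmn, hf x]
      have ho : ∀ f ∈ oddFunctions K P.L', T.toLinearMap f ∈ oddFunctions K P.L' := by
        intro f hf x
        change m (-x) * f (-x) = -(m x * f x)
        rw [hmn, hf x, mul_neg]
      refine ⟨he, ho, ?_⟩
      exact det_even_eq_det_odd_of_mul two_ne_zero (eq_zero_of_neg_eq h2) (by simp [hm]) _ hT he ho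
  rw [weilRep_eq_of_isWeilOperator h2 hψ P hW]
  rfl

/-- The Weil representation on the stabilizer of `L` and `L'`, up to scalars. -/
lemma exists_weilRep_apply_of_stabilizes (h2 : (2 : F) ≠ 0) (hψ : ψ ≠ 1) (P : Polarization B)
    {g : Sp B} (hL : ∀ x ∈ P.L, (g : V ≃ₗ[F] V) x ∈ P.L) (A : P.L' ≃ₗ[F] P.L')
    (hA : ∀ x : P.L', (A x : V) = (g : V ≃ₗ[F] V) x) :
    ∃ c : K, c ≠ 0 ∧ ∀ f x, weilRep h2 hψ P g f x = c * f (A.symm x) := by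
  have hne : LinearMap.funLeft K K A.symm ≠ 0 := by
    intro h
    have := LinearMap.congr_fun h 1
    exact one_ne_zero (congrFun this 0)
  obtain ⟨c, hc, h⟩ := exists_weilRep_eq_smul h2 hψ P (intertwines_funLeft P hL A hA) hne
  refine ⟨c, hc, fun f x => ?_⟩
  rw [h]
  rfl

/-- The Weil representation on the elements which act on `L' ≅ E × E` as `diag (t, t)`, where `t` is
conjugate to its inverse. -/
lemma weilRep_apply_of_diag {E : Type*} [AddCommGroup E] [Module F E]
    (h2 : (2 : F) ≠ 0) (hψ : ψ ≠ 1) (P : Polarization B)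
    {g : Sp B} (hL : ∀ x ∈ P.L, (g : V ≃ₗ[F] V) x ∈ P.L) (A : P.L' ≃ₗ[F] P.L')
    (hA : ∀ x : P.L', (A x : V) = (g : V ≃ₗ[F] V) x)
    (e : P.L' ≃ₗ[F] (Fin 2 → E)) (t s : E ≃ₗ[F] E)
    (hts : s * t * s⁻¹ = t⁻¹) (hAt : ∀ x i, e (A x) i = t (e x i)) (f : P.L' → K) (x : P.L') :
    weilRep h2 hψ P g f x = f (A.symm x) := by
  have he : ∀ f ∈ evenFunctions K P.L', LinearMap.funLeft K K A.symm f ∈ evenFunctions K P.L' := by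
    intro f hf x
    simp only [LinearMap.funLeft_apply, map_neg]
    exact hf _
  have ho : ∀ f ∈ oddFunctions K P.L', LinearMap.funLeft K K A.symm f ∈ oddFunctions K P.L' := by
    intro f hf x
    simp only [LinearMap.funLeft_apply, map_neg]
    exact hf _
  have hW : IsWeilOperator ψ P g (LinearEquiv.funCongrLeft K K A.symm.toEquiv) :=
    ⟨intertwines_funLeft P hL A hA, he, ho,
      det_even_eq_det_odd_of_diag e t s hts hAt he ho⟩
  rw [weilRep_eq_of_isWeilOperator h2 hψ P hW]
  rfl

end WeilFormulas

/-! ### The orthogonal group of the anisotropic plane `E` -/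

section OrthogonalPlane

lemma one_ne_neg_one_units {F : Type*} [Field F] (h2 : (2 : F) ≠ 0) : (1 : Fˣ) ≠ -1 := by
  intro h
  have h' := congrArg Units.val h
  rw [Units.val_one, Units.val_neg, Units.val_one] at h'
  exact h2 (by linear_combination h')

/-- The group of the elements of norm `1`. -/
abbrev NormOne (F E : Type*) [Fintype F] [Field E] : Subgroup Eˣ :=
  (powMonoidHom (Fintype.card F + 1) : Eˣ →* Eˣ).ker

lemma NormOne.val_pow {F E : Type*} [Fintype F] [Field E] (u : NormOne F E) : ((u : Eˣ) : E) ^ Fintype.card F = ((u : Eˣ) : E)⁻¹ := by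
  have h : (u : Eˣ) ^ (Fintype.card F + 1) = 1 := u.2
  have h' := congrArg Units.val h
  rw [Units.val_pow_eq_pow_val, pow_succ, Units.val_one] at h'
  exact eq_inv_of_mul_eq_one_left h'

variable {F E : Type*} [Field F] [Fintype F] [Field E] [Algebra F E] [FiniteDimensional F E]

lemma algebraMap_normForm_self (hE : Module.finrank F E = 2) (h2 : (2 : F) ≠ 0) (x : E) :
    algebraMap F E (normForm F E x x) = x ^ (Fintype.card F + 1) := by
  have h2' : (2 : E) ≠ 0 := by
    rw [← map_ofNat (algebraMap F E) 2]
    simpa using h2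
  rw [algebraMap_normForm hE]
  field_simp
  ring

/-- The quadratic form is the field norm `x ^ (q + 1)`. This anisotropy turns the vanishing of a
quadratic form into that of a vector, both in the separation of orbits and in the vanishing of fixed
vectors. -/
lemma normForm_self_eq_zero (hE : Module.finrank F E = 2) (h2 : (2 : F) ≠ 0) {x : E}
    (hx : normForm F E x x = 0) : x = 0 := by
  have h := algebraMap_normForm_self hE h2 x
  rw [hx, map_zero] at h
  exact pow_eq_zero_iff (Nat.succ_ne_zero _) |>.1 h.symm

/-- The multiplication by an element of norm `1`. -/
def rotation (hE : Module.finrank F E = 2) (u : NormOne F E) : OrthogonalGroup F E :=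
  ⟨DistribMulAction.toLinearEquiv F E (u : Eˣ), by
    intro x y
    apply (algebraMap F E).injective
    have hu : ((u : Eˣ) : E) ≠ 0 := (u : Eˣ).ne_zero
    simp only [algebraMap_normForm hE, DistribMulAction.toLinearEquiv_apply, Units.smul_def,
      smul_eq_mul, mul_pow, NormOne.val_pow]
    field_simp⟩

lemma rotation_apply (hE : Module.finrank F E = 2) (u : NormOne F E) (x : E) :
    (rotation hE u : E ≃ₗ[F] E) x = ((u : Eˣ) : E) * x := rfl

lemma conjugationO_mul_self (hE : Module.finrank F E = 2) :
    conjugationO (F := F) (E := E) hE * conjugationO hE = 1 := by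
  apply Subtype.ext
  apply LinearEquiv.ext
  intro x
  exact pow_card_pow_card hE x

lemma conjugationO_inv (hE : Module.finrank F E = 2) :
    (conjugationO (F := F) (E := E) hE)⁻¹ = conjugationO hE :=
  inv_eq_of_mul_eq_one_right (conjugationO_mul_self hE)

lemma exists_conjugation_ne (hE : Module.finrank F E = 2) : ∃ y : E, y ^ Fintype.card F ≠ y := by
  have : Finite E := Module.finite_of_finite F
  by_contra! h
  have h1 : FiniteField.frobeniusAlgEquivOfAlgebraic F E = 1 := AlgEquiv.ext h
  have h2 := FiniteField.orderOf_frobeniusAlgEquivOfAlgebraic F E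
  rw [h1, orderOf_one, hE] at h2
  omega

/-- The determinant of the multiplication by `u` is the norm of `u` from `E` to `F`, namely `u ^ (1
+ q)`. -/
lemma det_rotation (hE : Module.finrank F E = 2) (u : NormOne F E) :
    LinearEquiv.det (rotation hE u : E ≃ₗ[F] E) = 1 := by
  have : Finite E := Module.finite_of_finite F
  apply Units.ext
  apply (algebraMap F E).injective
  have h1 : LinearMap.det ((rotation hE u : E ≃ₗ[F] E) : E →ₗ[F] E)
      = Algebra.norm F ((u : Eˣ) : E) := rfl
  have h2 : (u : Eˣ) ^ (Fintype.card F + 1) = 1 := u.2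
  rw [LinearEquiv.coe_det, h1, FiniteField.algebraMap_norm_eq_prod_pow, hE,
    Finset.prod_range_succ, Finset.prod_range_one, Nat.card_eq_fintype_card, pow_zero, pow_one,
    pow_one, ← pow_succ', ← Units.val_pow_eq_pow_val, h2]
  simp

/-- An isometry which fixes `1` is trivial or the conjugation. -/
lemma eq_one_or_eq_conjugationO (h2 : (2 : F) ≠ 0) (hE : Module.finrank F E = 2)
    (t : OrthogonalGroup F E) (ht : (t : E ≃ₗ[F] E) 1 = 1) : t = 1 ∨ t = conjugationO hE := by
  have h2' : (2 : E) ≠ 0 := by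
    rw [← map_ofNat (algebraMap F E) 2]
    simpa using h2
  -- Pairing with `1` shows that `t y` and `y` have the same trace, and the quadratic form that they
  -- have the same norm; so `t y` is a root of `(X - y) (X - y ^ q)`.
  have key : ∀ y : E, (t : E ≃ₗ[F] E) y = y ∨ (t : E ≃ₗ[F] E) y = y ^ Fintype.card F := by
    intro y
    set z := (t : E ≃ₗ[F] E) y with hz
    have e1 := congrArg (algebraMap F E) (t.2 y 1)
    have e2 := congrArg (algebraMap F E) (t.2 y y)
    rw [ht, ← hz, algebraMap_normForm hE, algebraMap_normForm hE, one_pow] at e1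
    rw [← hz, algebraMap_normForm_self hE h2, algebraMap_normForm_self hE h2, pow_succ,
      pow_succ] at e2
    have e3 : z + z ^ Fintype.card F = y + y ^ Fintype.card F := by
      field_simp at e1
      linear_combination e1
    have e4 : (z - y) * (z - y ^ Fintype.card F) = 0 := by
      linear_combination z * e3 - e2
    rcases mul_eq_zero.1 e4 with h | h
    · exact Or.inl (sub_eq_zero.1 h)
    · exact Or.inr (sub_eq_zero.1 h)
  -- An additive group is not the union of two proper subgroups: if `a` is not fixed by `t`, and `t
  -- b` is not the conjugate of `b`, then `a + b` satisfies neither alternative of `key`.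
  by_contra! hcon
  obtain ⟨h1, h3⟩ := hcon
  have ha : ∃ a, (t : E ≃ₗ[F] E) a ≠ a := by
    by_contra! h
    exact h1 (Subtype.ext (LinearEquiv.ext h))
  have hb : ∃ b, (t : E ≃ₗ[F] E) b ≠ conjugation F E b := by
    by_contra! h
    exact h3 (Subtype.ext (LinearEquiv.ext h))
  obtain ⟨a, ha⟩ := ha
  obtain ⟨b, hb⟩ := hb
  have ha' : (t : E ≃ₗ[F] E) a = conjugation F E a := (key a).resolve_left ha
  have hb' : (t : E ≃ₗ[F] E) b = b := (key b).resolve_right hb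
  rcases key (a + b) with h | h
  · rw [map_add, hb', add_left_inj] at h
    exact ha h
  · rw [← conjugation_apply, map_add, map_add, ha', add_right_inj] at h
    exact hb h

/-- The image `t 1` has norm `1`; rotating it back to `1` leaves an isometry which fixes `1`. -/
lemma orthogonalGroup_cases (h2 : (2 : F) ≠ 0) (hE : Module.finrank F E = 2)
    (t : OrthogonalGroup F E) :
    ∃ u : NormOne F E, t = rotation hE u ∨ t = rotation hE u * conjugationO hE := by
  have h0 : (t : E ≃ₗ[F] E) 1 ≠ 0 := by
    rw [Ne, LinearEquiv.map_eq_zero_iff]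
    exact one_ne_zero
  have hu : (Units.mk0 _ h0) ∈ NormOne F E := by
    rw [MonoidHom.mem_ker]
    apply Units.ext
    have h := congrArg (algebraMap F E) (t.2 1 1)
    rw [algebraMap_normForm_self hE h2, algebraMap_normForm_self hE h2, one_pow] at h
    exact h
  refine ⟨⟨_, hu⟩, ?_⟩
  set u : NormOne F E := ⟨_, hu⟩
  have h1 : (((rotation hE u)⁻¹ * t : OrthogonalGroup F E) : E ≃ₗ[F] E) 1 = 1 := by
    change (rotation hE u : E ≃ₗ[F] E).symm ((t : E ≃ₗ[F] E) 1) = 1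
    rw [LinearEquiv.symm_apply_eq, rotation_apply, mul_one]
    rfl
  rcases eq_one_or_eq_conjugationO h2 hE _ h1 with h | h
  · left
    rwa [inv_mul_eq_one, eq_comm] at h
  · right
    rw [← h, mul_inv_cancel_left]

lemma det_conjugation (h2 : (2 : F) ≠ 0) (hE : Module.finrank F E = 2) :
    LinearEquiv.det (conjugation F E) = -1 := by
  obtain ⟨y, hy⟩ := exists_conjugation_ne (F := F) hE
  -- The conjugation is diagonal in the basis `1`, `δ`, with eigenvalues `1` and `-1`.
  set δ : E := y - conjugation F E y with hδ
  have hδ0 : δ ≠ 0 := fun h => hy (sub_eq_zero.1 h).symm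
  have h1 : conjugation F E 1 = 1 := one_pow _
  have hσ : conjugation F E δ = -δ := by
    rw [hδ, map_sub, neg_sub]
    congr 1
    exact pow_card_pow_card hE y
  have hli : LinearIndependent F ![(1 : E), δ] := by
    rw [LinearIndependent.pair_iff]
    intro a c h
    have h' := congrArg (conjugation F E) h
    rw [map_add, map_smul, map_smul, h1, hσ, map_zero] at h'
    have ha : (2 * a) • (1 : E) = 0 := by
      rw [mul_smul, two_smul]
      calc a • (1 : E) + a • 1 = (a • 1 + c • δ) + (a • 1 + c • -δ) := by rw [smul_neg]; abel
        _ = 0 := by rw [h, h', add_zero]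
    have ha0 : a = 0 := by simpa [h2] using ha
    subst ha0
    simpa [hδ0] using h
  let b := basisOfLinearIndependentOfCardEqFinrank hli (by simp [hE])
  have hb0 : b 0 = 1 := by simp [b]
  have hb1 : b 1 = δ := by simp [b]
  apply Units.ext
  rw [LinearEquiv.coe_det, ← LinearMap.det_toMatrix b, Matrix.det_fin_two]
  have e0 : conjugation F E (b 0) = b 0 := by rw [hb0, h1]
  have e1 : conjugation F E (b 1) = -b 1 := by rw [hb1, hσ]
  simp [LinearMap.toMatrix_apply, e0, e1]

lemma det_rotation_mul_conjugationO (h2 : (2 : F) ≠ 0) (hE : Module.finrank F E = 2)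
    (u : NormOne F E) :
    LinearEquiv.det ((rotation hE u * conjugationO hE : OrthogonalGroup F E) : E ≃ₗ[F] E) = -1 := by
  rw [Subgroup.coe_mul, map_mul, det_rotation, one_mul]
  exact det_conjugation h2 hE

lemma det_eq_one_or (h2 : (2 : F) ≠ 0) (hE : Module.finrank F E = 2) (t : OrthogonalGroup F E) :
    LinearEquiv.det (t : E ≃ₗ[F] E) = 1 ∨ LinearEquiv.det (t : E ≃ₗ[F] E) = -1 := by
  obtain ⟨u, rfl | rfl⟩ := orthogonalGroup_cases h2 hE t
  · exact Or.inl (det_rotation hE u)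
  · exact Or.inr (det_rotation_mul_conjugationO h2 hE u)

lemma exists_rotation (h2 : (2 : F) ≠ 0) (hE : Module.finrank F E = 2) (t : OrthogonalGroup F E)
    (ht : LinearEquiv.det (t : E ≃ₗ[F] E) = 1) : ∃ u, t = rotation hE u := by
  obtain ⟨u, rfl | rfl⟩ := orthogonalGroup_cases h2 hE t
  · exact ⟨u, rfl⟩
  · rw [det_rotation_mul_conjugationO h2] at ht
    exact absurd ht.symm (one_ne_neg_one_units h2)

/-- Rotations are thus conjugate to their inverses, the condition under which their Weil operators
carry no scalar. -/
lemma conj_rotation (hE : Module.finrank F E = 2) (u : NormOne F E) :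
    conjugationO hE * rotation hE u * (conjugationO hE)⁻¹ = (rotation hE u)⁻¹ := by
  rw [conjugationO_inv, eq_inv_iff_mul_eq_one]
  apply Subtype.ext
  apply LinearEquiv.ext
  intro x
  have hu : ((u : Eˣ) : E) ≠ 0 := (u : Eˣ).ne_zero
  change (((u : Eˣ) : E) * ((((u : Eˣ) : E) * x) ^ Fintype.card F)) ^ Fintype.card F = x
  rw [mul_pow, NormOne.val_pow, pow_card_pow_card hE, inv_mul_cancel_left₀ hu]

/-- The sign character of the orthogonal group. -/
def orthogonalSign (K : Type*) [Field K] (t : OrthogonalGroup F E) : K :=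
  open Classical in if LinearEquiv.det (t : E ≃ₗ[F] E) = 1 then 1 else -1

variable {K : Type*} [Field K]

lemma orthogonalSign_one : orthogonalSign K (1 : OrthogonalGroup F E) = 1 :=
  if_pos (map_one _)

lemma orthogonalSign_rotation (hE : Module.finrank F E = 2) (u : NormOne F E) :
    orthogonalSign K (rotation hE u) = 1 :=
  if_pos (det_rotation hE u)

lemma orthogonalSign_mul (h2 : (2 : F) ≠ 0) (hE : Module.finrank F E = 2)
    (s t : OrthogonalGroup F E) :
    orthogonalSign K (s * t) = orthogonalSign K s * orthogonalSign K t := by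
  have h := (one_ne_neg_one_units h2).symm
  unfold orthogonalSign
  rw [Subgroup.coe_mul, map_mul]
  rcases det_eq_one_or h2 hE s with hs | hs <;> rcases det_eq_one_or h2 hE t with ht | ht <;>
    simp [hs, ht, h]

lemma orthogonalSign_conjugationO (h2 : (2 : F) ≠ 0) (hE : Module.finrank F E = 2) :
    orthogonalSign K (conjugationO (F := F) (E := E) hE) = -1 := by
  refine if_neg ?_
  have h : LinearEquiv.det (conjugationO (F := F) (E := E) hE : E ≃ₗ[F] E) = -1 :=
    det_conjugation h2 hE
  rw [h]
  exact (one_ne_neg_one_units h2).symm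

/-- The group is the disjoint union of the rotations and of their products with the conjugation,
told apart by the determinant. As `Eˣ` is cyclic of order `q ^ 2 - 1`, it has `gcd (q ^ 2 - 1, q +
1) = q + 1` elements of norm `1`. -/
lemma card_orthogonalGroup (h2 : (2 : F) ≠ 0) (hE : Module.finrank F E = 2) :
    Nat.card (OrthogonalGroup F E) = 2 * (Fintype.card F + 1) := by
  have : Finite E := Module.finite_of_finite F
  have hcard : Nat.card (NormOne F E) = Fintype.card F + 1 := by
    rw [IsCyclic.card_powMonoidHom_ker, Nat.card_units, Module.natCard_eq_pow_finrank (K := F), hE,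
      Nat.card_eq_fintype_card]
    have : Fintype.card F ^ 2 - 1 = (Fintype.card F + 1) * (Fintype.card F - 1) := by
      rw [← Nat.sq_sub_sq, one_pow]
    rw [this, Nat.gcd_mul_right_left]
  have hinj : Function.Injective (rotation (F := F) (E := E) hE) := by
    intro u v h
    have h := congrArg (fun t : OrthogonalGroup F E => (t : E ≃ₗ[F] E) 1) h
    simp only [rotation_apply, mul_one] at h
    exact Subtype.ext (Units.ext h)
  let f : NormOne F E ⊕ NormOne F E → OrthogonalGroup F E :=
    Sum.elim (rotation hE) (fun u => rotation hE u * conjugationO hE)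
  have hf : Function.Bijective f := by
    constructor
    · refine hinj.sumElim (fun u v h => hinj (mul_right_cancel h)) fun u v h => ?_
      have h' := congrArg (fun t : OrthogonalGroup F E => LinearEquiv.det (t : E ≃ₗ[F] E)) h
      simp only [det_rotation, det_rotation_mul_conjugationO h2] at h'
      exact one_ne_neg_one_units h2 h'
    · intro t
      obtain ⟨u, h | h⟩ := orthogonalGroup_cases h2 hE t
      · exact ⟨Sum.inl u, h.symm⟩
      · exact ⟨Sum.inr u, h.symm⟩
  rw [← Nat.card_eq_of_bijective f hf, Nat.card_sum, hcard, two_mul]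

lemma card_linearEquiv (hE : Module.finrank F E = 2) :
    Nat.card (E ≃ₗ[F] E) = (Fintype.card F ^ 2 - 1) * (Fintype.card F ^ 2 - Fintype.card F) := by
  let b := (Module.finBasisOfFinrankEq F E hE)
  rw [Nat.card_congr ((LinearMap.GeneralLinearGroup.generalLinearEquiv F E).symm.toEquiv.trans
    (Units.mapEquiv (LinearMap.toMatrixAlgEquiv b).toMulEquiv).toEquiv)]
  have h := Matrix.card_GL_field (𝔽 := F) 2
  rw [Fin.prod_univ_two] at h
  simpa using h

/-- An element of `E` is fixed by an improper isometry. -/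
lemma exists_rotation_mul_conjugationO_fix (hE : Module.finrank F E = 2) (x : E) :
    ∃ u : NormOne F E, ((rotation hE u * conjugationO hE : OrthogonalGroup F E) : E ≃ₗ[F] E) x
      = x := by
  by_cases hx : x = 0
  · exact ⟨1, by rw [hx, map_zero]⟩
  -- The improper isometry is `e ↦ (x / x ^ q) e ^ q`; its coefficient has norm `1` because `x ^ (q
  -- ^ 2) = x`.
  have hu : Units.mk0 x hx / Units.mk0 x hx ^ Fintype.card F ∈ NormOne F E := by
    rw [MonoidHom.mem_ker]
    apply Units.ext
    rw [powMonoidHom_apply, Units.val_pow_eq_pow_val, Units.val_div_eq_div_val,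
      Units.val_pow_eq_pow_val, Units.val_mk0, Units.val_one, pow_succ, div_pow,
      pow_card_pow_card hE]
    field_simp
  refine ⟨⟨_, hu⟩, ?_⟩
  change (((Units.mk0 x hx / Units.mk0 x hx ^ Fintype.card F : Eˣ)) : E) * x ^ Fintype.card F = x
  simp only [Units.val_pow_eq_pow_val, Units.val_div_eq_div_val, Units.val_mk0]
  field_simp

end OrthogonalPlane

/-! ### Transvections, Siegel transformations and Levi elements -/

section Isometries

variable {F V : Type*} [Field F] [AddCommGroup V] [Module F V] (B : SymplecticForm F V)

lemma form_injective_of_isometry (g : V →ₗ[F] V) (hg : ∀ x y, B.form (g x) (g y) = B.form x y) :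
    Function.Injective g := by
  rw [← LinearMap.ker_eq_bot, LinearMap.ker_eq_bot']
  intro x hx
  refine B.nondegenerate.1 x fun y => ?_
  rw [← hg, hx, map_zero, LinearMap.zero_apply]

/-- An endomorphism which preserves the form, as an element of the symplectic group. -/
def spOfIsometry [FiniteDimensional F V] (g : V →ₗ[F] V)
    (hg : ∀ x y, B.form (g x) (g y) = B.form x y) : Sp B :=
  ⟨LinearEquiv.ofInjectiveEndo g (form_injective_of_isometry B g hg), hg⟩

/-- The transformation `x ↦ x + ⟨x, u⟩ v + ⟨x, v⟩ u`, for `u` and `v` orthogonal. If `v = c u`, this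
is a transvection. -/
def siegel [FiniteDimensional F V] (u v : V) (huv : B.form u v = 0) : Sp B :=
  spOfIsometry B (LinearMap.id + (B.form.flip u).smulRight v + (B.form.flip v).smulRight u) (by
    intro x y
    have hvu : B.form v u = 0 := by rw [B.swap, huv, neg_zero]
    simp only [LinearMap.add_apply, LinearMap.id_apply, LinearMap.smulRight_apply,
      LinearMap.BilinForm.flip_apply, map_add, map_smul, LinearMap.smul_apply, smul_eq_mul, huv,
      hvu, B.isAlt u, B.isAlt v]
    rw [B.swap u y, B.swap v y]
    ring)

variable {B}

lemma siegel_apply [FiniteDimensional F V] {u v : V} (huv : B.form u v = 0) (x : V) :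
    (siegel B u v huv : V ≃ₗ[F] V) x = x + B.form x u • v + B.form x v • u := rfl

lemma conj_siegel [FiniteDimensional F V] (g : Sp B) {u v : V} (huv : B.form u v = 0) :
    g * siegel B u v huv * g⁻¹ = siegel B ((g : V ≃ₗ[F] V) u) ((g : V ≃ₗ[F] V) v)
      ((g.2 u v).trans huv) := by
  rw [mul_inv_eq_iff_eq_mul]
  apply Subtype.ext
  apply LinearEquiv.ext
  intro x
  change (g : V ≃ₗ[F] V) ((siegel B u v huv : V ≃ₗ[F] V) x)
    = (siegel B _ _ ((g.2 u v).trans huv) : V ≃ₗ[F] V) ((g : V ≃ₗ[F] V) x)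
  rw [siegel_apply, siegel_apply, map_add, map_add, map_smul, map_smul, g.2, g.2]

lemma form_smul_self (B : SymplecticForm F V) (v : V) (c : F) : B.form v (c • v) = 0 := by
  rw [map_smul, B.isAlt v, smul_zero]

/-- The symplectic group is transitive on the nonzero vectors. -/
lemma exists_sp_apply_eq [FiniteDimensional F V] (h2 : (2 : F) ≠ 0) {v w : V} (hv : v ≠ 0)
    (hw : w ≠ 0) : ∃ g : Sp B, (g : V ≃ₗ[F] V) v = w := by
  have key : ∀ v w : V, B.form v w ≠ 0 → ∃ g : Sp B, (g : V ≃ₗ[F] V) v = w := by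
    intro v w hvw
    -- With `d = w - v`, `siegel B d (k • d)` sends `x` to `x + 2 k ⟨x, d⟩ d`. As `⟨v, d⟩ = ⟨v, w⟩`,
    -- the value `k = 1 / (2 ⟨v, w⟩)` sends `v` to `v + d = w`.
    refine ⟨siegel B (w - v) ((2 * B.form v w)⁻¹ • (w - v)) (form_smul_self B _ _), ?_⟩
    rw [siegel_apply, map_smul, map_sub, B.isAlt v, sub_zero, smul_smul, smul_eq_mul, add_assoc,
      ← add_smul]
    have : B.form v w * (2 * B.form v w)⁻¹ + (2 * B.form v w)⁻¹ * B.form v w = 1 := by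
      field_simp
      norm_num
    rw [this, one_smul, add_sub_cancel]
  have hne : ∀ v : V, v ≠ 0 → ∃ u, B.form v u ≠ 0 := by
    intro v hv
    by_contra! h
    exact hv (B.nondegenerate.1 v h)
  -- When `⟨v, w⟩` may vanish, one passes through a vector `u` orthogonal to neither; it exists
  -- because two hyperplanes do not cover `V`.
  obtain ⟨u, hu, hu'⟩ : ∃ u, B.form v u ≠ 0 ∧ B.form u w ≠ 0 := by
    obtain ⟨a, ha⟩ := hne v hv
    obtain ⟨b, hb⟩ := hne w hw
    rw [B.swap, neg_ne_zero] at hb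
    by_cases ha' : B.form a w = 0
    · by_cases hb' : B.form v b = 0
      · exact ⟨a + b, by simpa [hb'] using ha, by simpa [ha'] using hb⟩
      · exact ⟨b, hb', hb⟩
    · exact ⟨a, ha, ha'⟩
  obtain ⟨g, hg⟩ := key v u hu
  obtain ⟨g', hg'⟩ := key u w hu'
  exact ⟨g' * g, by rw [Subgroup.coe_mul, LinearEquiv.mul_apply, hg, hg']⟩

namespace Polarization

variable (P : Polarization B)

/-- The polarization with the two subspaces exchanged. -/
def symm : Polarization B := ⟨P.L', P.L, P.isCompl.symm, P.isotropic', P.isotropic⟩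

/-- The map `L' → L^*` given by the form. -/
def toDual : P.L' →ₗ[F] Module.Dual F P.L :=
  LinearMap.lcomp F F P.L.subtype ∘ₗ B.form ∘ₗ P.L'.subtype

lemma toDual_injective : Function.Injective P.toDual := by
  rw [← LinearMap.ker_eq_bot, LinearMap.ker_eq_bot']
  intro x hx
  apply Subtype.ext
  refine B.nondegenerate.1 _ fun w => ?_
  rw [← P.proj_add_proj' w, map_add, P.isotropic' _ x.2 _ (P.proj' w).2, add_zero]
  exact LinearMap.congr_fun hx (P.proj w)

variable [FiniteDimensional F V]

/-- The form embeds each of `L`, `L'` into the dual of the other. -/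
lemma finrank_eq : Module.finrank F P.L = Module.finrank F P.L' := by
  have h1 := LinearMap.finrank_le_finrank_of_injective P.toDual_injective
  have h2 := LinearMap.finrank_le_finrank_of_injective P.symm.toDual_injective
  rw [Subspace.dual_finrank_eq] at h1 h2
  exact le_antisymm h2 h1

lemma finrank_add_finrank : Module.finrank F P.L + Module.finrank F P.L' = Module.finrank F V :=
  Submodule.finrank_add_eq_of_isCompl P.isCompl

/-- An automorphism of `L` extends to an isometry which preserves `L'`. -/
lemma exists_levi (a : P.L ≃ₗ[F] P.L) : ∃ g : Sp B,
    (∀ l : P.L, (g : V ≃ₗ[F] V) l = a l) ∧ ∀ x ∈ P.L', (g : V ≃ₗ[F] V) x ∈ P.L' := by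
  let D : P.L' ≃ₗ[F] Module.Dual F P.L := LinearEquiv.ofInjectiveOfFinrankEq P.toDual
    P.toDual_injective (by rw [Subspace.dual_finrank_eq, P.finrank_eq])
  have hD : ∀ x l, D x l = B.form (x : V) (l : V) := fun x l => rfl
  -- The contragredient of `a` through `L' ≅ L^*`, the only choice which preserves the pairing
  -- between `L` and `L'`.
  let a' : P.L' →ₗ[F] P.L' := D.symm.toLinearMap ∘ₗ a.symm.toLinearMap.dualMap ∘ₗ D.toLinearMap
  have ha' : ∀ x l, B.form (a' x : V) (a l : V) = B.form (x : V) (l : V) := by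
    intro x l
    rw [← hD, ← hD]
    simp [a']
  let g : V →ₗ[F] V := P.L.subtype ∘ₗ a.toLinearMap ∘ₗ P.proj + P.L'.subtype ∘ₗ a' ∘ₗ P.proj'
  have hg : ∀ w, g w = (a (P.proj w) : V) + a' (P.proj' w) := fun w => rfl
  have hL : ∀ l : P.L, g l = a l := by
    intro l
    have e1 : P.proj (l : V) = l := Submodule.projectionOnto_apply_left P.isCompl l
    have e2 : P.proj' (l : V) = 0 := Submodule.projectionOnto_apply_right P.isCompl.symm l
    rw [hg, e1, e2, map_zero, Submodule.coe_zero, add_zero]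
  have hL' : ∀ x : P.L', g x = a' x := by
    intro x
    have e1 : P.proj' (x : V) = x := Submodule.projectionOnto_apply_left P.isCompl.symm x
    have e2 : P.proj (x : V) = 0 := Submodule.projectionOnto_apply_right P.isCompl x
    rw [hg, e1, e2, map_zero, Submodule.coe_zero, zero_add]
  refine ⟨spOfIsometry B g ?_, hL, ?_⟩
  · intro x y
    rw [form_eq P x y, hg, hg]
    simp only [map_add, LinearMap.add_apply]
    rw [P.isotropic _ (a _).2 _ (a _).2, P.isotropic' _ (a' _).2 _ (a' _).2, ha',
      B.swap (a (P.proj x) : V), ha', ← B.swap]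
    ring
  · intro x hx
    change g x ∈ P.L'
    rw [hL' ⟨x, hx⟩]
    exact (a' _).2

end Polarization

end Isometries

/-! ### The model of the Weil representation on functions on `Hom (L, E)` -/

section TensorModel

variable {F E V : Type*} [Field F] [Field E] [Algebra F E] [AddCommGroup V] [Module F V]
  {B : SymplecticForm F V}

variable (B E) in
/-- The contraction `v ⊗ e ↦ (w ↦ ⟨v, w⟩ e)`. -/
def contraction : V ⊗[F] E →ₗ[F] V →ₗ[F] E :=
  TensorProduct.lift (LinearMap.smulRightₗ ∘ₗ B.form)

lemma contraction_tmul (v w : V) (e : E) : contraction E B (v ⊗ₜ e) w = B.form v w • e := rfl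

lemma tensorSubspace_induction {L : Submodule F V} {p : V ⊗[F] E → Prop} (h0 : p 0)
    (hadd : ∀ x y, p x → p y → p (x + y)) (htmul : ∀ v ∈ L, ∀ e, p (v ⊗ₜ e)) :
    ∀ x ∈ tensorSubspace E L, p x := by
  rintro _ ⟨x, rfl⟩
  induction x with
  | zero => simpa using h0
  | add a b ha hb => rw [map_add]; exact hadd _ _ ha hb
  | tmul v e => exact htmul v v.2 e

lemma tmul_mem_tensorSubspace {L : Submodule F V} {v : V} (hv : v ∈ L) (e : E) :
    v ⊗ₜ e ∈ tensorSubspace E L := ⟨⟨v, hv⟩ ⊗ₜ e, rfl⟩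

variable [Fintype F] [FiniteDimensional F E] (h2 : (2 : F) ≠ 0) (hE : Module.finrank F E = 2)

lemma tensor_form_tmul (x : V ⊗[F] E) (v : V) (e : E) :
    (B.tensor (E := E) h2 hE).form x (v ⊗ₜ e) = normForm F E (contraction E B x v) e := by
  induction x with
  | zero => simp
  | add a b ha hb => simp only [map_add, LinearMap.add_apply, ha, hb]
  | tmul w e' =>
    rw [contraction_tmul, map_smul, LinearMap.smul_apply, smul_eq_mul, mul_comm]
    rfl

lemma dualPair_tmul (a : Sp B × OrthogonalGroup F E) (v : V) (e : E) :
    (dualPair B h2 hE a : V ⊗[F] E ≃ₗ[F] V ⊗[F] E) (v ⊗ₜ e)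
      = (a.1 : V ≃ₗ[F] V) v ⊗ₜ (a.2 : E ≃ₗ[F] E) e := rfl

/-- Equivariance of the contraction: `g ⊗ t` becomes `y ↦ t ∘ y ∘ g⁻¹` on linear maps. -/
lemma contraction_dualPair (a : Sp B × OrthogonalGroup F E) (x : V ⊗[F] E) (v : V) :
    contraction E B ((dualPair B h2 hE a : V ⊗[F] E ≃ₗ[F] V ⊗[F] E) x) ((a.1 : V ≃ₗ[F] V) v)
      = (a.2 : E ≃ₗ[F] E) (contraction E B x v) := by
  induction x with
  | zero => simp
  | add c d hc hd => simp only [map_add, LinearMap.add_apply, hc, hd]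
  | tmul w e => rw [dualPair_tmul, contraction_tmul, contraction_tmul, a.1.2, map_smul]

lemma dualPair_mem_tensorSubspace {L : Submodule F V} {a : Sp B × OrthogonalGroup F E}
    (h : ∀ x ∈ L, (a.1 : V ≃ₗ[F] V) x ∈ L) :
    ∀ x ∈ tensorSubspace E L,
      (dualPair B h2 hE a : V ⊗[F] E ≃ₗ[F] V ⊗[F] E) x ∈ tensorSubspace E L := by
  refine tensorSubspace_induction ?_ ?_ ?_
  · rw [map_zero]
    exact Submodule.zero_mem _
  · intro x y hx hy
    rw [map_add]
    exact add_mem hx hy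
  · intro v hv e
    exact tmul_mem_tensorSubspace (h v hv) _

variable (P : Polarization B)

/-- The contraction as a map from `L' ⊗ E` to `Hom (L, E)`. -/
def contractionHom : (P.tensor (E := E) h2 hE).L' →ₗ[F] (P.L →ₗ[F] E) :=
  LinearMap.lcomp F E P.L.subtype ∘ₗ contraction E B ∘ₗ (P.tensor (E := E) h2 hE).L'.subtype

/-- An element with zero contraction on `L` is orthogonal to `L ⊗ E`; it is orthogonal to `L' ⊗ E`
by isotropy, hence to the whole of `V ⊗ E`. -/
lemma contractionHom_injective : Function.Injective (contractionHom h2 hE P) := by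
  rw [← LinearMap.ker_eq_bot, LinearMap.ker_eq_bot']
  intro x hx
  apply Subtype.ext
  refine (B.tensor (E := E) h2 hE).nondegenerate.1 _ fun w => ?_
  rw [← (P.tensor (E := E) h2 hE).proj_add_proj' w, map_add,
    (P.tensor (E := E) h2 hE).isotropic' _ x.2 _ ((P.tensor (E := E) h2 hE).proj' w).2, add_zero]
  refine tensorSubspace_induction (L := P.L)
    (p := fun z => (B.tensor (E := E) h2 hE).form (x : V ⊗[F] E) z = 0) ?_ ?_ ?_ _
    ((P.tensor (E := E) h2 hE).proj w).2
  · exact map_zero _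
  · intro y z hy hz
    rw [map_add, hy, hz, add_zero]
  · intro v hv e
    have h : contraction E B (x : V ⊗[F] E) v = 0 := LinearMap.congr_fun hx ⟨v, hv⟩
    rw [tensor_form_tmul, h, map_zero, LinearMap.zero_apply]

variable [FiniteDimensional F V]

/-- The identification of `L' ⊗ E` with `Hom (L, E)`. -/
def contractionEquiv : (P.tensor (E := E) h2 hE).L' ≃ₗ[F] (P.L →ₗ[F] E) :=
  LinearEquiv.ofInjectiveOfFinrankEq (contractionHom h2 hE P) (contractionHom_injective h2 hE P) (by
    have h := LinearMap.finrank_range_of_inj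
      (Module.Flat.rTensor_preserves_injective_linearMap (M := E) P.L'.subtype
        P.L'.injective_subtype)
    refine h.trans ?_
    rw [Module.finrank_tensorProduct, Module.finrank_linearMap, P.finrank_eq])

lemma contractionEquiv_apply (x : (P.tensor (E := E) h2 hE).L') (l : P.L) :
    contractionEquiv h2 hE P x l = contraction E B (x : V ⊗[F] E) (l : V) := rfl

/-- The restriction to `L' ⊗ E` of an element of the dual pair which stabilizes it. -/
def restrictDualPair (a : Sp B × OrthogonalGroup F E)
    (h : ∀ x ∈ P.L', (a.1 : V ≃ₗ[F] V) x ∈ P.L') :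
    (P.tensor (E := E) h2 hE).L' ≃ₗ[F] (P.tensor (E := E) h2 hE).L' :=
  LinearEquiv.ofInjectiveEndo
    ((dualPair B h2 hE a : V ⊗[F] E ≃ₗ[F] V ⊗[F] E).toLinearMap.restrict
      (dualPair_mem_tensorSubspace h2 hE h))
    fun _ _ hxy => Subtype.ext ((dualPair B h2 hE a : V ⊗[F] E ≃ₗ[F] V ⊗[F] E).injective
      (congrArg Subtype.val hxy))

lemma restrictDualPair_apply (a : Sp B × OrthogonalGroup F E)
    (h : ∀ x ∈ P.L', (a.1 : V ≃ₗ[F] V) x ∈ P.L') (x : (P.tensor (E := E) h2 hE).L') :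
    (restrictDualPair h2 hE P a h x : V ⊗[F] E)
      = (dualPair B h2 hE a : V ⊗[F] E ≃ₗ[F] V ⊗[F] E) x := rfl

variable {K : Type*} [Field K] [CharZero K] {ψ : AddChar F K} (hψ : ψ ≠ 1)

/-- The action of the isometries of `E` which are conjugate to their inverses. -/
lemma dualPairRep_orthogonal (hL : Module.finrank F P.L = 2) {t s : OrthogonalGroup F E}
    (hts : s * t * s⁻¹ = t⁻¹) (f : (P.tensor (E := E) h2 hE).L' → K) (y : P.L →ₗ[F] E) :
    dualPairRep h2 hE hψ P (1, t) f ((contractionEquiv h2 hE P).symm ((t : E ≃ₗ[F] E) ∘ₗ y))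
      = f ((contractionEquiv h2 hE P).symm y) := by
  have : Finite (V ⊗[F] E) := Module.finite_of_finite F
  -- A basis of the plane `L` gives `Hom (L, E) ≅ E × E`, on which `y ↦ t ∘ y` is `diag (t, t)`.
  let b := Module.finBasisOfFinrankEq F P.L hL
  have h1 : ∀ x ∈ P.L', (((1, t) : Sp B × OrthogonalGroup F E).1 : V ≃ₗ[F] V) x ∈ P.L' :=
    fun x hx => hx
  have hA : ∀ x, contractionEquiv h2 hE P (restrictDualPair h2 hE P (1, t) h1 x)
      = (t : E ≃ₗ[F] E) ∘ₗ contractionEquiv h2 hE P x := by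
    intro x
    apply LinearMap.ext
    intro l
    exact contraction_dualPair h2 hE ((1 : Sp B), t) (x : V ⊗[F] E) (l : V)
  have h := weilRep_apply_of_diag h2 hψ (P.tensor (E := E) h2 hE) (g := dualPair B h2 hE (1, t))
    (dualPair_mem_tensorSubspace h2 hE fun x hx => hx) (restrictDualPair h2 hE P (1, t) h1)
    (restrictDualPair_apply h2 hE P (1, t) h1)
    ((contractionEquiv h2 hE P).trans (b.constr F).symm) t s (congrArg Subtype.val hts)
    (fun x i => by
      simp only [LinearEquiv.trans_apply, hA]
      rfl) f
    (restrictDualPair h2 hE P (1, t) h1 ((contractionEquiv h2 hE P).symm y))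
  rw [LinearEquiv.symm_apply_apply] at h
  rw [← h]
  change weilRep h2 hψ _ _ _ _ = _
  refine congrArg (weilRep h2 hψ (P.tensor (E := E) h2 hE) (dualPair B h2 hE (1, t)) f) ?_
  rw [LinearEquiv.symm_apply_eq, hA, LinearEquiv.apply_symm_apply]

/-- The action of the automorphisms of `L`, up to scalars. -/
lemma exists_dualPairRep_levi (a : P.L ≃ₗ[F] P.L) : ∃ (g : Sp B) (c : K), c ≠ 0 ∧
    ∀ (f : (P.tensor (E := E) h2 hE).L' → K) (y : P.L →ₗ[F] E),
      dualPairRep h2 hE hψ P (g, 1) f ((contractionEquiv h2 hE P).symm y)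
        = c * f ((contractionEquiv h2 hE P).symm (y ∘ₗ a)) := by
  have : Finite (V ⊗[F] E) := Module.finite_of_finite F
  obtain ⟨g, hgL, hgL'⟩ := P.exists_levi a
  have hA : ∀ x l, contractionEquiv h2 hE P (restrictDualPair h2 hE P (g, 1) hgL' x) (a l)
      = contractionEquiv h2 hE P x l := by
    intro x l
    have h := contraction_dualPair h2 hE (g, (1 : OrthogonalGroup F E)) x (l : V)
    rw [hgL] at h
    exact h
  obtain ⟨c, hc, h⟩ := exists_weilRep_apply_of_stabilizes (K := K) h2 hψ
    (P.tensor (E := E) h2 hE) (g := dualPair B h2 hE (g, 1))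
    (dualPair_mem_tensorSubspace h2 hE fun x hx => by
      rw [hgL ⟨x, hx⟩]
      exact (a _).2)
    (restrictDualPair h2 hE P (g, 1) hgL') (restrictDualPair_apply h2 hE P (g, 1) hgL')
  refine ⟨g, c, hc, fun f y => (h f _).trans ?_⟩
  congr 2
  rw [LinearEquiv.symm_apply_eq, LinearEquiv.symm_apply_eq]
  apply LinearMap.ext
  intro l
  obtain ⟨l, rfl⟩ := a.surjective l
  rw [hA, LinearEquiv.apply_symm_apply]
  rfl

/-- The action of the transvections along the vectors of `L`. -/
lemma dualPairRep_transvection (l : P.L) (c : F) (f : (P.tensor (E := E) h2 hE).L' → K)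
    (y : P.L →ₗ[F] E) :
    dualPairRep h2 hE hψ P (siegel B (l : V) (c • (l : V)) (form_smul_self B _ _), 1) f
        ((contractionEquiv h2 hE P).symm y)
      = ψ (-c * normForm F E (y l) (y l)) * f ((contractionEquiv h2 hE P).symm y) := by
  have : Finite (V ⊗[F] E) := Module.finite_of_finite F
  set g := siegel B (l : V) (c • (l : V)) (form_smul_self B _ _) with hg
  have hgt : ∀ x : V ⊗[F] E, (dualPair B h2 hE (g, 1) : V ⊗[F] E ≃ₗ[F] V ⊗[F] E) x
      = x + (l : V) ⊗ₜ ((2 * c) • contraction E B x l) := by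
    intro x
    induction x with
    | zero => simp
    | add a b ha hb =>
      rw [map_add, ha, hb, map_add, LinearMap.add_apply, smul_add, TensorProduct.tmul_add]
      abel
    | tmul v e =>
      rw [dualPair_tmul, contraction_tmul, hg, siegel_apply, add_assoc, TensorProduct.add_tmul]
      congr 1
      rw [map_smul, smul_smul, smul_smul, ← add_smul, TensorProduct.smul_tmul, smul_eq_mul]
      change (l : V) ⊗ₜ[F] (_ • e) = _
      congr 2
      ring
  have hL : ∀ x ∈ (P.tensor (E := E) h2 hE).L,
      (dualPair B h2 hE (g, 1) : V ⊗[F] E ≃ₗ[F] V ⊗[F] E) x = x := by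
    refine tensorSubspace_induction ?_ ?_ ?_
    · exact map_zero _
    · intro x y hx hy
      rw [map_add, hx, hy]
    · intro v hv e
      rw [hgt, contraction_tmul, P.isotropic _ hv _ l.2, zero_smul, smul_zero,
        TensorProduct.tmul_zero, add_zero]
  have hL' : ∀ x ∈ (P.tensor (E := E) h2 hE).L',
      (dualPair B h2 hE (g, 1) : V ⊗[F] E ≃ₗ[F] V ⊗[F] E) x - x ∈ (P.tensor (E := E) h2 hE).L := by
    intro x _
    rw [hgt, add_sub_cancel_left]
    exact tmul_mem_tensorSubspace l.2 _
  refine (weilRep_apply_of_fix h2 hψ (P.tensor (E := E) h2 hE) hL hL' f _).trans ?_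
  -- For `x` with contraction `y`, `⟨x, g x⟩ = ⟨x, l ⊗ 2 c y l⟩ = 2 c N (y l)`; the factor `-1 / 2`
  -- of the Weil operator leaves `-c N (y l)`.
  congr 2
  set x := (contractionEquiv h2 hE P).symm y with hx
  have hy : contraction E B (x : V ⊗[F] E) l = y l := by
    rw [← contractionEquiv_apply, hx, LinearEquiv.apply_symm_apply]
  rw [hgt, map_add, (B.tensor (E := E) h2 hE).isAlt, tensor_form_tmul, hy, map_smul, smul_eq_mul]
  field_simp
  ring

end TensorModel

/-! ### Functions on `Hom (L, E)` of sign type under `O(E)` -/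

section SignFunctions

lemma eq_of_addChar_mul_eq {F K : Type*} [Field F] [Field K] {ψ : AddChar F K} (hψ : ψ ≠ 1)
    {a b : F}    (h : ∀ c, ψ (-c * a) = ψ (-c * b)) : a = b := by
  obtain ⟨z, hz⟩ := AddChar.ne_one_iff.1 hψ
  by_contra hab
  apply hz
  have hab' : b - a ≠ 0 := sub_ne_zero.2 (Ne.symm hab)
  -- For this value of `c` the two arguments `-c a` and `-c b` differ by `z`, so equality would give
  -- `ψ z = 1`.
  have h1 := h (z / (b - a))
  have h2 : z = -(z / (b - a)) * a - -(z / (b - a)) * b := by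
    field_simp
    ring
  rw [h2, AddChar.map_sub_eq_div, h1, div_self (ψ.val_isUnit _).ne_zero]

variable {F E L : Type*} [Field F] [Fintype F] [Field E] [Algebra F E] [FiniteDimensional F E]
  [AddCommGroup L] [Module F L] {K : Type*} [Field K]

variable (F E L K) in
/-- The functions on `Hom (L, E)` which transform under the orthogonal group by its sign
character. -/
def signFunctions :
    Submodule K ((L →ₗ[F] E) → K) where
  carrier := {f | ∀ (t : OrthogonalGroup F E) y,
    f (((t : E ≃ₗ[F] E) : E →ₗ[F] E) ∘ₗ y) = orthogonalSign K t * f y}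
  add_mem' := by
    intro a b ha hb t y
    rw [Pi.add_apply, Pi.add_apply, ha, hb, mul_add]
  zero_mem' := by
    intro t y
    simp
  smul_mem' := by
    intro c f hf t y
    rw [Pi.smul_apply, Pi.smul_apply, hf, smul_eq_mul, smul_eq_mul, mul_left_comm]

/-- The sign functions vanish at the maps which are not injective. -/
lemma signFunctions_apply_eq_zero [FiniteDimensional F L] [CharZero K]
    (h2 : (2 : F) ≠ 0) (hE : Module.finrank F E = 2)
    (hL : Module.finrank F L = 2) {f : (L →ₗ[F] E) → K} (hf : f ∈ signFunctions F E L K)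
    {y : L →ₗ[F] E} {l : L} (hl : l ≠ 0) (hy : y l = 0) : f y = 0 := by
  have hker : 1 ≤ Module.finrank F (LinearMap.ker y) := by
    rw [Nat.one_le_iff_ne_zero, Ne, Submodule.finrank_eq_zero]
    intro h
    exact hl ((Submodule.eq_bot_iff _).1 h l hy)
  have hrange : Module.finrank F (LinearMap.range y) ≤ 1 := by
    have := y.finrank_range_add_finrank_ker
    omega
  -- The image of `y` lies in a line `F e`. An improper isometry fixing `e` fixes `y`, whence `f y =
  -- -f y`.
  obtain ⟨e, he⟩ := finrank_le_one_iff.1 hrange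
  obtain ⟨u, hu⟩ := exists_rotation_mul_conjugationO_fix hE (e : E)
  set t := rotation hE u * conjugationO hE with ht
  have hty : ((t : E ≃ₗ[F] E) : E →ₗ[F] E) ∘ₗ y = y := by
    apply LinearMap.ext
    intro x
    obtain ⟨c, hc⟩ := he ⟨y x, LinearMap.mem_range_self y x⟩
    have hc' : c • (e : E) = y x := congrArg Subtype.val hc
    rw [LinearMap.comp_apply, ← hc', map_smul]
    congr 1
  have hs : orthogonalSign K t = -1 := by
    rw [orthogonalSign, if_neg]
    rw [ht, det_rotation_mul_conjugationO h2]
    exact (one_ne_neg_one_units h2).symm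
  have h := hf t y
  rw [hty, hs] at h
  have h' : (2 : K) * f y = 0 := by linear_combination h
  exact (mul_eq_zero.1 h').resolve_left two_ne_zero

lemma exists_equiv_of_apply_ne_zero [FiniteDimensional F L] [CharZero K]
    (h2 : (2 : F) ≠ 0) (hE : Module.finrank F E = 2)
    (hL : Module.finrank F L = 2) {f : (L →ₗ[F] E) → K} (hf : f ∈ signFunctions F E L K)
    {y : L →ₗ[F] E} (hy : f y ≠ 0) : ∃ z : L ≃ₗ[F] E, (z : L →ₗ[F] E) = y := by
  have hinj : Function.Injective y := by
    rw [← LinearMap.ker_eq_bot, LinearMap.ker_eq_bot']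
    intro l hl
    by_contra hl0
    exact hy (signFunctions_apply_eq_zero h2 hE hL hf hl0 hl)
  exact ⟨LinearEquiv.ofInjectiveOfFinrankEq y hinj (hL.trans hE.symm), rfl⟩

/-- The orbit of an isomorphism `y : L ≃ E` under the orthogonal group. -/
def orbitRel (y : L ≃ₗ[F] E) (t : OrthogonalGroup F E) (z : L →ₗ[F] E) : Prop :=
  z = ((t : E ≃ₗ[F] E) : E →ₗ[F] E) ∘ₗ (y : L →ₗ[F] E)

/-- The group acts freely on isomorphisms, so the sign used in `orbitFunction` is well defined. -/
lemma orbitRel_unique {y : L ≃ₗ[F] E} {t s : OrthogonalGroup F E} {z : L →ₗ[F] E}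
    (ht : orbitRel y t z) (hs : orbitRel y s z) : t = s := by
  apply Subtype.ext
  apply LinearEquiv.ext
  intro x
  obtain ⟨l, rfl⟩ := y.surjective x
  exact LinearMap.congr_fun (ht.symm.trans hs) l

variable (K) in
/-- The sign function supported on the orbit of `y`, with value `1` at `y`. -/
def orbitFunction (y : L ≃ₗ[F] E) (z : L →ₗ[F] E) : K :=
  open Classical in
  if h : ∃ t, orbitRel y t z then orthogonalSign K h.choose else 0

lemma orbitFunction_of_rel {y : L ≃ₗ[F] E} {t : OrthogonalGroup F E} {z : L →ₗ[F] E}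
    (h : orbitRel y t z) : orbitFunction K y z = orthogonalSign K t := by
  have h' : ∃ t, orbitRel y t z := ⟨t, h⟩
  rw [orbitFunction, dif_pos h', orbitRel_unique h'.choose_spec h]

lemma orbitFunction_of_not_rel {y : L ≃ₗ[F] E} {z : L →ₗ[F] E}
    (h : ¬ ∃ t, orbitRel y t z) : orbitFunction K y z = 0 := dif_neg h

lemma orbitFunction_self (y : L ≃ₗ[F] E) : orbitFunction K y (y : L →ₗ[F] E) = 1 := by
  rw [orbitFunction_of_rel (y := y) (t := 1) (z := y) rfl, orthogonalSign_one]

lemma orbitFunction_mem (h2 : (2 : F) ≠ 0) (hE : Module.finrank F E = 2)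
    (y : L ≃ₗ[F] E) :
    orbitFunction K y ∈ signFunctions F E L K := by
  intro t z
  by_cases h : ∃ s, orbitRel y s z
  · obtain ⟨s, hs⟩ := h
    have hts : orbitRel y (t * s) (((t : E ≃ₗ[F] E) : E →ₗ[F] E) ∘ₗ z) := by
      rw [hs]
      rfl
    rw [orbitFunction_of_rel hs, orbitFunction_of_rel hts, orthogonalSign_mul h2 hE]
  · rw [orbitFunction_of_not_rel h, orbitFunction_of_not_rel, mul_zero]
    rintro ⟨s, hs⟩
    refine h ⟨t⁻¹ * s, ?_⟩
    apply LinearMap.ext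
    intro l
    apply (t : E ≃ₗ[F] E).injective
    refine (LinearMap.congr_fun hs l).trans ?_
    exact ((t : E ≃ₗ[F] E).apply_symm_apply _).symm

/-- Representatives of the orbits of the isomorphisms `L ≃ E` under the orthogonal group. -/
def orbitRep (y : L ≃ₗ[F] E) (x : (E ≃ₗ[F] E) ⧸ OrthogonalGroup F E) : L ≃ₗ[F] E :=
  y.trans x.out.symm

lemma exists_orbitRel_orbitRep (y z : L ≃ₗ[F] E) :
    ∃ x t, orbitRel (orbitRep y x) t (z : L →ₗ[F] E) := by
  -- Here `z = a⁻¹ ∘ y`, and the chosen representative of the coset of `a` is `a s` with `s` an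
  -- isometry; hence `z = s ∘ (a s)⁻¹ ∘ y`.
  let a : E ≃ₗ[F] E := z.symm.trans y
  obtain ⟨s, hs⟩ := QuotientGroup.mk_out_eq_mul (OrthogonalGroup F E) a
  refine ⟨QuotientGroup.mk a, s, ?_⟩
  apply LinearMap.ext
  intro l
  change z l = (s : E ≃ₗ[F] E) ((QuotientGroup.mk a : (E ≃ₗ[F] E) ⧸ OrthogonalGroup F E).out.symm
    (y l))
  rw [hs]
  change z l = (s : E ≃ₗ[F] E) ((s : E ≃ₗ[F] E).symm (z (y.symm (y l))))
  simp

lemma eq_of_orbitRel_orbitRep {y : L ≃ₗ[F] E} {x x' : (E ≃ₗ[F] E) ⧸ OrthogonalGroup F E}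
    {t : OrthogonalGroup F E} (h : orbitRel (orbitRep y x) t (orbitRep y x' : L →ₗ[F] E)) :
    x = x' := by
  rw [← QuotientGroup.out_eq' x, ← QuotientGroup.out_eq' x', QuotientGroup.eq]
  have h1 : (x'.out)⁻¹ = (t : E ≃ₗ[F] E) * (x.out)⁻¹ := by
    apply LinearEquiv.ext
    intro e
    have h1 := LinearMap.congr_fun h (y.symm e)
    simpa [orbitRep] using h1
  have h' : (x.out)⁻¹ * x'.out = (t : E ≃ₗ[F] E)⁻¹ := by
    rw [← inv_inj, mul_inv_rev, inv_inv, inv_inv, h1, inv_mul_cancel_right]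
  rw [h']
  exact inv_mem t.2

/-- A sign function is a combination of orbit functions. -/
lemma eq_sum_orbitFunction [FiniteDimensional F L] [CharZero K]
    (h2 : (2 : F) ≠ 0) (hE : Module.finrank F E = 2)
    (hL : Module.finrank F L = 2)
    (y : L ≃ₗ[F] E) [Fintype ((E ≃ₗ[F] E) ⧸ OrthogonalGroup F E)]
    {f : (L →ₗ[F] E) → K} (hf : f ∈ signFunctions F E L K) :
    f = ∑ x, f (orbitRep y x) • orbitFunction K (orbitRep y x) := by
  funext z
  rw [Finset.sum_apply]
  by_cases h : ∃ x t, orbitRel (orbitRep y x) t z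
  · obtain ⟨x, t, h⟩ := h
    rw [Finset.sum_eq_single x]
    · rw [Pi.smul_apply, orbitFunction_of_rel h, smul_eq_mul, mul_comm]
      conv_lhs => rw [h]
      exact hf _ _
    · intro x' _ hx'
      rw [Pi.smul_apply, orbitFunction_of_not_rel, smul_zero]
      rintro ⟨s, hs⟩
      refine hx' (eq_of_orbitRel_orbitRep (y := y) (t := s⁻¹ * t) ?_).symm
      apply LinearMap.ext
      intro l
      apply (s : E ≃ₗ[F] E).injective
      exact (LinearMap.congr_fun (hs.symm.trans h) l).trans
        ((s : E ≃ₗ[F] E).apply_symm_apply _).symm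
    · intro h
      exact absurd (Finset.mem_univ _) h
  · have hfz : f z = 0 := by
      by_contra hne
      obtain ⟨z, rfl⟩ := exists_equiv_of_apply_ne_zero h2 hE hL hf hne
      exact h (exists_orbitRel_orbitRep y z)
    rw [hfz, Finset.sum_eq_zero]
    intro x _
    rw [Pi.smul_apply, orbitFunction_of_not_rel (fun h' => h ⟨x, h'⟩), smul_zero]

/-- Evaluation at one representative of each orbit of isomorphisms is bijective: it is injective
since sign functions vanish elsewhere, and the orbit functions provide preimages. -/
lemma finrank_signFunctions [FiniteDimensional F L] [CharZero K]
    (h2 : (2 : F) ≠ 0) (hE : Module.finrank F E = 2)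
    (hL : Module.finrank F L = 2) :
    Module.finrank K (signFunctions F E L K)
      = Nat.card ((E ≃ₗ[F] E) ⧸ OrthogonalGroup F E) := by
  classical
  have : Finite E := Module.finite_of_finite F
  have : Finite (E ≃ₗ[F] E) := Finite.of_injective _ DFunLike.coe_injective
  have := Fintype.ofFinite ((E ≃ₗ[F] E) ⧸ OrthogonalGroup F E)
  let y : L ≃ₗ[F] E := LinearEquiv.ofFinrankEq L E (hL.trans hE.symm)
  let R : signFunctions F E L K →ₗ[K] ((E ≃ₗ[F] E) ⧸ OrthogonalGroup F E → K) :=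
    LinearMap.funLeft K K (fun x => (orbitRep y x : L →ₗ[F] E)) ∘ₗ Submodule.subtype _
  have hR : Function.Bijective R := by
    constructor
    · intro f g hfg
      apply Subtype.ext
      rw [eq_sum_orbitFunction h2 hE hL y f.2, eq_sum_orbitFunction h2 hE hL y g.2]
      refine Finset.sum_congr rfl fun x _ => ?_
      congr 1
      exact congrFun hfg x
    · intro h
      refine ⟨⟨∑ x, h x • orbitFunction K (orbitRep y x),
        Submodule.sum_mem _ fun x _ => Submodule.smul_mem _ _ (orbitFunction_mem h2 hE _)⟩, ?_⟩
      funext x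
      change (∑ x, h x • orbitFunction K (orbitRep y x)) (orbitRep y x : L →ₗ[F] E) = h x
      rw [Finset.sum_apply, Finset.sum_eq_single x]
      · rw [Pi.smul_apply, orbitFunction_self, smul_eq_mul, mul_one]
      · intro x' _ hx'
        rw [Pi.smul_apply, orbitFunction_of_not_rel, smul_zero]
        rintro ⟨t, ht⟩
        exact hx' (eq_of_orbitRel_orbitRep ht)
      · intro h
        exact absurd (Finset.mem_univ _) h
  rw [(LinearEquiv.ofBijective R hR).finrank_eq, Module.finrank_fintype_fun_eq_card,
    Nat.card_eq_fintype_card]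

/-- The index of `O(E)` in `GL(E)` is `(q ^ 2 - 1) (q ^ 2 - q) / (2 (q + 1))`; the factor `q + 1`
cancels. -/
lemma finrank_signFunctions_eq [FiniteDimensional F L] [CharZero K]
    (h2 : (2 : F) ≠ 0) (hE : Module.finrank F E = 2)
    (hL : Module.finrank F L = 2) :
    (Module.finrank K (signFunctions F E L K) : ℚ)
      = (Fintype.card F : ℚ) * ((Fintype.card F : ℚ) - 1) ^ 2 / 2 := by
  have h := Subgroup.card_eq_card_quotient_mul_card_subgroup (OrthogonalGroup F E)
  rw [card_linearEquiv hE, card_orthogonalGroup h2 hE,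
    ← finrank_signFunctions (K := K) h2 hE hL] at h
  have hq : 1 ≤ Fintype.card F := Fintype.card_pos
  have h' := congrArg (Nat.cast (R := ℚ)) h
  rw [Nat.cast_mul, Nat.cast_sub (Nat.one_le_pow _ _ hq),
    Nat.cast_sub (Nat.le_self_pow two_ne_zero _)] at h'
  push_cast at h'
  have hq' : (Fintype.card F : ℚ) + 1 ≠ 0 := by positivity
  rw [eq_div_iff two_ne_zero]
  apply mul_right_cancel₀ hq'
  linear_combination -h'

/-- An isomorphism and a map which induce the same quadratic form on `L` are in the same orbit. -/
lemma exists_orbitRel_of_normForm_eq {y : L ≃ₗ[F] E} {z : L →ₗ[F] E} (h2 : (2 : F) ≠ 0)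
    (hE : Module.finrank F E = 2)
    (h : ∀ l, normForm F E (z l) (z l) = normForm F E (y l) (y l)) : ∃ t, orbitRel y t z := by
  -- Polarization, where `2` is inverted. The transporting isometry is then `z ∘ y⁻¹`, injective
  -- because the form is anisotropic.
  have hpol : ∀ l l', normForm F E (z l) (z l') = normForm F E (y l) (y l') := by
    intro l l'
    have h1 := h (l + l')
    simp only [map_add, LinearMap.add_apply, h] at h1
    rw [normForm_symm hE (z l') (z l), normForm_symm hE (y l') (y l)] at h1
    have h3 : (2 : F) * (normForm F E (z l) (z l') - normForm F E (y l) (y l')) = 0 := by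
      linear_combination h1
    exact sub_eq_zero.1 ((mul_eq_zero.1 h3).resolve_left h2)
  have hinj : Function.Injective (z ∘ₗ y.symm.toLinearMap) := by
    rw [← LinearMap.ker_eq_bot, LinearMap.ker_eq_bot']
    intro e he
    obtain ⟨l, rfl⟩ := y.surjective e
    apply normForm_self_eq_zero hE h2
    rw [← h]
    have hz : z l = 0 := by simpa using he
    rw [hz, map_zero]
  refine ⟨⟨LinearEquiv.ofInjectiveEndo _ hinj, fun e e' => ?_⟩, ?_⟩
  · obtain ⟨l, rfl⟩ := y.surjective e
    obtain ⟨l', rfl⟩ := y.surjective e'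
    simpa using hpol l l'
  · apply LinearMap.ext
    intro l
    simp

/-- A nonzero space of sign functions which is stable under `GL(L)` and under the multiplication
by the characters of the quadratic form is the space of all the sign functions. -/
lemma signFunctions_irreducible [FiniteDimensional F L] [CharZero K]
    (h2 : (2 : F) ≠ 0) (hE : Module.finrank F E = 2)
    (hL : Module.finrank F L = 2) {ψ : AddChar F K} (hψ : ψ ≠ 1)
    {S : Submodule K ((L →ₗ[F] E) → K)} (hS : S ≤ signFunctions F E L K)
    (hm : ∀ (l : L) (c : F), ∀ f ∈ S,
      (fun z : L →ₗ[F] E => ψ (-c * normForm F E (z l) (z l)) * f z) ∈ S)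
    (ha : ∀ a : L ≃ₗ[F] L, ∀ f ∈ S, (fun z : L →ₗ[F] E => f (z ∘ₗ (a : L →ₗ[F] L))) ∈ S)
    (hne : S ≠ ⊥) : S = signFunctions F E L K := by
  classical
  have : Finite E := Module.finite_of_finite F
  have : Finite L := Module.finite_of_finite F
  have : Finite (L →ₗ[F] E) := Finite.of_injective _ DFunLike.coe_injective
  have := Fintype.ofFinite (L →ₗ[F] E)
  have : Finite (E ≃ₗ[F] E) := Finite.of_injective _ DFunLike.coe_injective
  have := Fintype.ofFinite ((E ≃ₗ[F] E) ⧸ OrthogonalGroup F E)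
  have horbit : ∀ f ∈ S, ∀ y : L ≃ₗ[F] E, f y ≠ 0 → orbitFunction K y ∈ S := by
    intro f hf y hy
    -- For each `z` off the orbit of `y`, a multiplier preserving `S` which is `0` at `z` and `1` on
    -- the orbit. It is obtained by interpolation from a character `ψ (-c N (· l))` with values `α`
    -- at `z` and `β ≠ α` on the orbit.
    have hsep : ∀ z : L →ₗ[F] E, (¬ ∃ t, orbitRel y t z) → ∃ h : (L →ₗ[F] E) → K,
        (∀ g ∈ S, h * g ∈ S) ∧ h z = 0 ∧ ∀ t w, orbitRel y t w → h w = 1 := by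
      intro z hz
      obtain ⟨l, c, hlc⟩ : ∃ l c, ψ (-c * normForm F E (z l) (z l))
          ≠ ψ (-c * normForm F E (y l) (y l)) := by
        by_contra! hcon
        exact hz (exists_orbitRel_of_normForm_eq h2 hE
          fun l => eq_of_addChar_mul_eq hψ (hcon l))
      set α := ψ (-c * normForm F E (z l) (z l))
      set β := ψ (-c * normForm F E (y l) (y l)) with hβ
      have hβα : β - α ≠ 0 := sub_ne_zero.2 hlc.symm
      refine ⟨fun w => (β - α)⁻¹ * (ψ (-c * normForm F E (w l) (w l)) - α), ?_, ?_, ?_⟩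
      · intro g hg
        have h1 := S.smul_mem (β - α)⁻¹ (S.sub_mem (hm l c g hg) (S.smul_mem α hg))
        convert h1 using 1
        funext w
        simp only [Pi.mul_apply, Pi.smul_apply, Pi.sub_apply, smul_eq_mul]
        ring
      · simp [α]
      · intro t w hw
        have hw' : w l = (t : E ≃ₗ[F] E) (y l) := LinearMap.congr_fun hw l
        beta_reduce
        rw [hw', t.2, ← hβ, inv_mul_cancel₀ hβα]
    choose! h hhS hh0 hh1 using hsep
    -- The product of these multipliers is the indicator function of the orbit of `y`.
    set H : (L →ₗ[F] E) → K :=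
      ∏ z ∈ Finset.univ.filter (fun z => ¬ ∃ t, orbitRel y t z), h z with hH
    let p : ((L →ₗ[F] E) → K) → Prop := fun k => ∀ g ∈ S, k * g ∈ S
    have hHS : p H := by
      refine Finset.prod_induction h p ?_ ?_ ?_
      · intro a b hA hB g hg
        rw [mul_assoc]
        exact hA _ (hB g hg)
      · intro g hg
        rwa [one_mul]
      · intro z hz g hg
        exact hhS z (Finset.mem_filter.1 hz).2 g hg
    have key : orbitFunction K y = (f y)⁻¹ • (H * f) := by
      funext w
      rw [Pi.smul_apply, Pi.mul_apply, smul_eq_mul]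
      by_cases hw : ∃ t, orbitRel y t w
      · obtain ⟨t, ht⟩ := hw
        have h1 : H w = 1 := by
          rw [hH, Finset.prod_apply]
          exact Finset.prod_eq_one fun z hz => hh1 z (Finset.mem_filter.1 hz).2 t w ht
        have h2 : f w = orthogonalSign K t * f y := by
          rw [ht]
          exact hS hf t y
        rw [orbitFunction_of_rel ht, h1, h2]
        field_simp
      · have h1 : H w = 0 := by
          rw [hH, Finset.prod_apply]
          exact Finset.prod_eq_zero (Finset.mem_filter.2 ⟨Finset.mem_univ w, hw⟩) (hh0 w hw)
        rw [orbitFunction_of_not_rel hw, h1, zero_mul, mul_zero]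
    rw [key]
    exact S.smul_mem _ (hHS f hf)
  obtain ⟨f, hf, hf0⟩ := Submodule.exists_mem_ne_zero_of_ne_bot hne
  obtain ⟨y, hy⟩ := Function.ne_iff.1 hf0
  obtain ⟨y, rfl⟩ := exists_equiv_of_apply_ne_zero h2 hE hL (hS hf) hy
  have hall : ∀ z : L ≃ₗ[F] E, orbitFunction K z ∈ S := by
    intro z
    -- The automorphism `z⁻¹ ∘ y` of `L` moves the nonvanishing of `f` from `y` to `z`.
    refine horbit _ (ha (y.trans z.symm) f hf) z ?_
    have : (z : L →ₗ[F] E) ∘ₗ ((y.trans z.symm : L ≃ₗ[F] L) : L →ₗ[F] L) = y := by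
      apply LinearMap.ext
      intro l
      simp
    rw [this]
    exact hy
  refine le_antisymm hS fun g hg => ?_
  rw [eq_sum_orbitFunction h2 hE hL y hg]
  exact Submodule.sum_mem _ fun x _ => S.smul_mem _ (hall _)

end SignFunctions

/-! ### Dimension, irreducibility and fixed vectors of `W₁⁻` -/

section Model

variable {F E V : Type*} [Field F] [Fintype F] [Field E] [Algebra F E] [FiniteDimensional F E]
  [AddCommGroup V] [Module F V] [FiniteDimensional F V] {B : SymplecticForm F V}
  {K : Type*} [Field K] [CharZero K] {ψ : AddChar F K}
  (h2 : (2 : F) ≠ 0) (hE : Module.finrank F E = 2) (hψ : ψ ≠ 1) (P : Polarization B)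

/-- The functions on `L' ⊗ E` as functions on `Hom (L, E)`. -/
def modelEquiv (K : Type*) [Field K] :
    ((P.tensor (E := E) h2 hE).L' → K) ≃ₗ[K] ((P.L →ₗ[F] E) → K) :=
  LinearEquiv.funCongrLeft K K (contractionEquiv h2 hE P).symm.toEquiv

/-- Rotations and the conjugation both act by pure translation, with no scalar, and they generate
`O(E)`; the two defining conditions together therefore express the transformation by the sign
character. -/
lemma mem_W₁minus_iff (hL : Module.finrank F P.L = 2) (f : (P.tensor (E := E) h2 hE).L' → K) :
    f ∈ W₁minus (E := E) h2 hE hψ P ↔ modelEquiv h2 hE P K f ∈ signFunctions F E P.L K := by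
  have hrot : ∀ (u : NormOne F E) (f : (P.tensor (E := E) h2 hE).L' → K) y,
      modelEquiv h2 hE P K (dualPairRep h2 hE hψ P (1, rotation hE u) f)
        (((rotation hE u : E ≃ₗ[F] E) : E →ₗ[F] E) ∘ₗ y) = modelEquiv h2 hE P K f y :=
    fun u f y => dualPairRep_orthogonal h2 hE P hψ hL (conj_rotation hE u) f y
  have hconj : ∀ (f : (P.tensor (E := E) h2 hE).L' → K) y,
      modelEquiv h2 hE P K (dualPairRep h2 hE hψ P (1, conjugationO hE) f)
        (((conjugationO hE : E ≃ₗ[F] E) : E →ₗ[F] E) ∘ₗ y) = modelEquiv h2 hE P K f y :=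
    -- The conjugation is an involution, so it is its own inverse and `s = 1` serves.
    fun f y => dualPairRep_orthogonal h2 hE P hψ hL (s := 1)
      (by rw [one_mul, inv_one, mul_one, conjugationO_inv]) f y
  constructor
  · rintro ⟨h1, h3⟩
    have hr : ∀ (u : NormOne F E) y, modelEquiv h2 hE P K f
        (((rotation hE u : E ≃ₗ[F] E) : E →ₗ[F] E) ∘ₗ y) = modelEquiv h2 hE P K f y := by
      intro u y
      rw [← hrot u f y, h1 _ (det_rotation hE u)]
    intro t y
    obtain ⟨u, rfl | rfl⟩ := orthogonalGroup_cases h2 hE t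
    · rw [hr, orthogonalSign_rotation, one_mul]
    · rw [orthogonalSign_mul h2 hE, orthogonalSign_rotation, orthogonalSign_conjugationO h2 hE]
      refine (hr u (((conjugationO hE : E ≃ₗ[F] E) : E →ₗ[F] E) ∘ₗ y)).trans ?_
      rw [← hconj f y, h3, map_neg, Pi.neg_apply]
      ring
  · intro h
    have hsurj : ∀ (t : OrthogonalGroup F E) (y : P.L →ₗ[F] E), ∃ y',
        ((t : E ≃ₗ[F] E) : E →ₗ[F] E) ∘ₗ y' = y := by
      intro t y
      refine ⟨((t : E ≃ₗ[F] E).symm : E →ₗ[F] E) ∘ₗ y, ?_⟩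
      apply LinearMap.ext
      intro l
      exact (t : E ≃ₗ[F] E).apply_symm_apply _
    refine ⟨fun t ht => ?_, ?_⟩
    · obtain ⟨u, rfl⟩ := exists_rotation h2 hE t ht
      apply (modelEquiv h2 hE P K).injective
      funext y
      obtain ⟨y, rfl⟩ := hsurj (rotation hE u) y
      rw [hrot, h, orthogonalSign_rotation, one_mul]
    · apply (modelEquiv h2 hE P K).injective
      funext y
      obtain ⟨y, rfl⟩ := hsurj (conjugationO hE) y
      rw [hconj, map_neg, Pi.neg_apply, h, orthogonalSign_conjugationO h2 hE]
      ring

lemma finrank_W₁minus (hL : Module.finrank F P.L = 2) :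
    (Module.finrank K (W₁minus (E := E) h2 hE hψ P) : ℚ)
      = (Fintype.card F : ℚ) * ((Fintype.card F : ℚ) - 1) ^ 2 / 2 := by
  have h : W₁minus (E := E) h2 hE hψ P
      = (signFunctions F E P.L K).comap (modelEquiv h2 hE P K).toLinearMap :=
    Submodule.ext (mem_W₁minus_iff h2 hE hψ P hL)
  rw [h, ((modelEquiv h2 hE P K).ofSubmodule' _).finrank_eq]
  exact finrank_signFunctions_eq h2 hE hL

theorem W₁minusRep_isIrreducible (hL : Module.finrank F P.L = 2) :
    (W₁minusRep (E := E) h2 hE hψ P).IsIrreducible := by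
  have hmem : ∀ f : W₁minus (E := E) h2 hE hψ P,
      modelEquiv h2 hE P K (f : (P.tensor (E := E) h2 hE).L' → K) ∈ signFunctions F E P.L K :=
    fun f => (mem_W₁minus_iff h2 hE hψ P hL _).1 f.2
  have hnt : Nontrivial (W₁minus (E := E) h2 hE hψ P) := by
    apply Module.nontrivial_of_finrank_pos (R := K)
    have h := finrank_W₁minus h2 hE hψ P hL
    have hq : (1 : ℚ) < Fintype.card F := by exact_mod_cast Fintype.one_lt_card
    have h' : (0 : ℚ) < Module.finrank K (W₁minus (E := E) h2 hE hψ P) := by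
      rw [h]
      have : (0 : ℚ) < (Fintype.card F : ℚ) - 1 := by linarith
      positivity
    exact_mod_cast h'
  refine { exists_pair_ne := ⟨⊥, ⊤, fun h => ?_⟩, eq_bot_or_eq_top := fun S => ?_ }
  · exact bot_ne_top (α := Submodule K (W₁minus (E := E) h2 hE hψ P))
      (congrArg Subrepresentation.toSubmodule h)
  · rw [or_iff_not_imp_left]
    intro hS
    let R : W₁minus (E := E) h2 hE hψ P →ₗ[K] ((P.L →ₗ[F] E) → K) :=
      (modelEquiv h2 hE P K).toLinearMap ∘ₗ Submodule.subtype _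
    have hR : Function.Injective R :=
      (modelEquiv h2 hE P K).injective.comp Subtype.val_injective
    have key : S.toSubmodule.map R = signFunctions F E P.L K := by
      refine signFunctions_irreducible h2 hE hL hψ ?_ ?_ ?_ ?_
      · rintro _ ⟨f, -, rfl⟩
        exact hmem f
      · rintro l c _ ⟨f, hf, rfl⟩
        refine ⟨_, S.apply_mem_toSubmodule (siegel B (l : V) (c • (l : V)) (form_smul_self B _ _))
          hf, ?_⟩
        funext y
        exact dualPairRep_transvection h2 hE P hψ l c f y
      · rintro a _ ⟨f, hf, rfl⟩
        obtain ⟨g, c, hc, h⟩ := exists_dualPairRep_levi (K := K) h2 hE P hψ a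
        -- The unknown scalar in the action of the Levi element is harmless, since a subspace
        -- absorbs it.
        refine ⟨_, S.toSubmodule.smul_mem c⁻¹ (S.apply_mem_toSubmodule g hf), ?_⟩
        funext y
        rw [map_smul, Pi.smul_apply, smul_eq_mul]
        have h' := h f y
        rw [inv_mul_eq_iff_eq_mul₀ hc]
        exact h'
      · intro h
        exact hS (Subrepresentation.toSubmodule_injective
          (Submodule.map_injective_of_injective hR (h.trans (Submodule.map_bot R).symm)))
    apply Subrepresentation.toSubmodule_injective
    refine eq_top_iff.2 fun f _ => ?_
    have hf : R f ∈ S.toSubmodule.map R := by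
      rw [key]
      exact hmem f
    obtain ⟨f', hf', h⟩ := hf
    rwa [← hR h]

/-- A vector of `W₁⁻` fixed by the transvections along a line vanishes. -/
lemma eq_zero_of_transvections_fix (hL : Module.finrank F P.L = 2) {v : V} (hv : v ≠ 0)
    (f : W₁minus (E := E) h2 hE hψ P)
    (hf : ∀ c : F, W₁minusRep (E := E) h2 hE hψ P
      (siegel B v (c • v) (form_smul_self B v c)) f = f) : f = 0 := by
  set ρ := W₁minusRep (E := E) h2 hE hψ P with hρ
  obtain ⟨l, hl⟩ : ∃ l : P.L, l ≠ 0 := by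
    have : Nontrivial P.L := Module.nontrivial_of_finrank_pos (R := F) (by omega)
    exact exists_ne 0
  -- Moving `v` to a vector `l` of `L` reduces to the transvections which act by multiplication.
  obtain ⟨g, hg⟩ := exists_sp_apply_eq (B := B) h2 hv
    (fun h => hl (Subtype.ext h) : (l : V) ≠ 0)
  have hfix : ∀ c : F, ρ (siegel B (l : V) (c • (l : V)) (form_smul_self B _ _)) (ρ g f)
      = ρ g f := by
    intro c
    have h1 : siegel B (l : V) (c • (l : V)) (form_smul_self B _ _)
        = g * siegel B v (c • v) (form_smul_self B v c) * g⁻¹ := by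
      rw [conj_siegel]
      congr 1
      · exact hg.symm
      · rw [map_smul, hg]
    rw [← Module.End.mul_apply, ← map_mul, h1, inv_mul_cancel_right, map_mul, Module.End.mul_apply,
      hf]
  have hz : ρ g f = 0 := by
    apply Subtype.ext
    apply (modelEquiv h2 hE P K).injective
    rw [Submodule.coe_zero, map_zero]
    funext y
    by_contra hne
    -- Where the fixed function is nonzero, all multipliers `ψ (-c N (y l))` equal `1`, so `N (y l)
    -- = 0`.
    have hy : y l = 0 := by
      apply normForm_self_eq_zero hE h2
      refine eq_of_addChar_mul_eq hψ fun c => ?_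
      have h1 := congrFun (congrArg Subtype.val (hfix c)) ((contractionEquiv h2 hE P).symm y)
      have h3 := (dualPairRep_transvection h2 hE P hψ l c
        ((ρ g f : W₁minus (E := E) h2 hE hψ P) : (P.tensor (E := E) h2 hE).L' → K) y).symm.trans h1
      rw [mul_zero, AddChar.map_zero_eq_one]
      exact mul_right_cancel₀ hne (h3.trans (one_mul _).symm)
    exact hne (signFunctions_apply_eq_zero h2 hE hL
      ((mem_W₁minus_iff h2 hE hψ P hL _).1 (ρ g f).2) hl hy)
  have h1 : ρ g⁻¹ (ρ g f) = f := by
    rw [← Module.End.mul_apply, ← map_mul, inv_mul_cancel, map_one, Module.End.one_apply]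
  rw [← h1, hz, map_zero]

end Model

/-! ### Transvections in the unipotent radicals and in the center of `U₀` -/

section UnipotentRadical

variable {F V : Type*} [Field F] [AddCommGroup V] [Module F V] [FiniteDimensional F V]
  {B : SymplecticForm F V}

/-- The flag `L₁ ⊂ ⋯ ⊂ Lₖ` has a first step. -/
lemma IsotropicFlag.exists_least (𝓕 : IsotropicFlag B) : ∃ W₀ ∈ 𝓕.spaces, ∀ W ∈ 𝓕.spaces,
    W₀ ≤ W := by
  obtain ⟨W₀, hW₀, hmin⟩ := WellFounded.has_min
    (wellFounded_lt (α := Submodule F V)) 𝓕.spaces 𝓕.nonempty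
  refine ⟨W₀, hW₀, fun W hW => ?_⟩
  rcases 𝓕.isChain.total hW₀ hW with h | h
  · exact h
  · exact (eq_of_le_of_not_lt h (hmin W hW)).ge

/-- If `v` is in the first step `L₁` of a flag and `z` is orthogonal to `L₁`, then the
transformation `x ↦ x + ⟨x, v⟩ z + ⟨x, z⟩ v` is in the unipotent radical. -/
lemma IsotropicFlag.siegel_mem_unipotentRadical (𝓕 : IsotropicFlag B) {W₀ : Submodule F V}
    (hW₀ : W₀ ∈ 𝓕.spaces) (hle : ∀ W ∈ 𝓕.spaces, W₀ ≤ W) {v z : V} (hv : v ∈ W₀)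
    (hz : ∀ w ∈ W₀, B.form w z = 0) : siegel B v z (hz v hv) ∈ 𝓕.unipotentRadical := by
  set W₁ : Submodule F V := B.form.orthogonal W₀ with hW₁
  have mem_W₁ : ∀ x, x ∈ W₁ ↔ ∀ w ∈ W₀, B.form w x = 0 := fun x => Iff.rfl
  have hW₀W₁ : W₀ ≤ W₁ := fun x hx => (mem_W₁ x).2 fun w hw => 𝓕.isotropic W₀ hW₀ w hw x hx
  have hW₀full : W₀ ∈ 𝓕.full := Or.inl (Or.inr hW₀)
  have hW₁full : W₁ ∈ 𝓕.full := Or.inr ⟨W₀, hW₀, rfl⟩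
  have hW₁top : W₁ < ⊤ := by
    rw [lt_top_iff_ne_top]
    intro h
    obtain ⟨w, hw, hw0⟩ := Submodule.exists_mem_ne_zero_of_ne_bot (𝓕.ne_bot W₀ hW₀)
    refine hw0 (B.nondegenerate.1 w fun x => ?_)
    exact (mem_W₁ x).1 (h ▸ Submodule.mem_top) w hw
  -- Apart from `0` and `V`, each step lies between `W₀` and its orthogonal `W₁`. The displacement
  -- `s x - x` lies in `W₁` always, in `F v ⊆ W₀` for `x ∈ W₁`, and is `0` for `x ∈ W₀`: each time
  -- within the previous step.
  have hcases : ∀ W ∈ 𝓕.full, W = ⊥ ∨ W = ⊤ ∨ (W₀ ≤ W ∧ W ≤ W₁) := by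
    rintro W ((hW | hW) | ⟨W', hW', rfl⟩)
    · rcases hW with rfl | rfl
      · exact Or.inl rfl
      · exact Or.inr (Or.inl rfl)
    · refine Or.inr (Or.inr ⟨hle W hW, fun x hx => (mem_W₁ x).2 fun w hw => ?_⟩)
      exact 𝓕.isotropic W hW w (hle W hW hw) x hx
    · refine Or.inr (Or.inr ⟨fun x hx w hw => ?_, fun x hx w hw => ?_⟩)
      · exact 𝓕.isotropic W' hW' w hw x (hle W' hW' hx)
      · exact hx w (hle W' hW' hw)
  set s := siegel B v z (hz v hv)
  have hs : ∀ x, (s : V ≃ₗ[F] V) x - x = B.form x v • z + B.form x z • v := by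
    intro x
    rw [siegel_apply]
    abel
  have hs₁ : ∀ x ∈ W₁, (s : V ≃ₗ[F] V) x - x = B.form x z • v := by
    intro x hx
    rw [hs, B.swap x v, (mem_W₁ x).1 hx v hv, neg_zero, zero_smul, zero_add]
  have hstep : ∀ W ∈ 𝓕.full, ∀ x ∈ W,
      (s : V ≃ₗ[F] V) x - x ∈ sSup {W' ∈ 𝓕.full | W' < W} := by
    intro W hW x hx
    rcases hcases W hW with rfl | rfl | ⟨h0, h1⟩
    · rw [(Submodule.mem_bot F).1 hx, map_zero, sub_zero]
      exact Submodule.zero_mem _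
    · have hle' : W₁ ≤ sSup {W' ∈ 𝓕.full | W' < ⊤} := le_sSup ⟨hW₁full, hW₁top⟩
      apply hle'
      rw [hs]
      exact add_mem (W₁.smul_mem _ ((mem_W₁ z).2 hz)) (W₁.smul_mem _ (hW₀W₁ hv))
    · rw [hs₁ x (h1 hx)]
      rcases h0.eq_or_lt with rfl | h0
      · rw [hz x hx, zero_smul]
        exact Submodule.zero_mem _
      · have hle' : W₀ ≤ sSup {W' ∈ 𝓕.full | W' < W} := le_sSup ⟨hW₀full, h0⟩
        exact hle' (W₀.smul_mem _ hv)
  refine ⟨fun W hW => ?_, hstep⟩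
  have hmap : W.map ((s : V ≃ₗ[F] V) : V →ₗ[F] V) ≤ W := by
    rintro _ ⟨x, hx, rfl⟩
    have h1 : sSup {W' ∈ 𝓕.full | W' < W} ≤ W := sSup_le fun W' hW' => hW'.2.le
    have h3 := W.add_mem (h1 (hstep W hW x hx)) hx
    rwa [sub_add_cancel] at h3
  exact Submodule.eq_of_le_of_finrank_eq hmap (LinearEquiv.finrank_map_eq _ _)

variable (b : SymplecticBasis B)

lemma SymplecticBasis.siegel_mem_U₀ {z : V} (hz : B.form (b.basis 0) z = 0) :
    siegel B (b.basis 0) z hz ∈ b.U₀ := by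
  refine b.flag.siegel_mem_unipotentRadical (W₀ := F ∙ b.basis 0) (Or.inl rfl) ?_
    (Submodule.mem_span_singleton_self _) ?_
  · rintro W (rfl | rfl)
    · exact le_rfl
    · exact Submodule.span_mono (by simp)
  · intro w hw
    obtain ⟨c, rfl⟩ := Submodule.mem_span_singleton.1 hw
    rw [map_smul, LinearMap.smul_apply, hz, smul_zero]

omit [FiniteDimensional F V] in
lemma SymplecticBasis.apply_basis_zero {u : Sp B} (hu : u ∈ b.U₀) :
    (u : V ≃ₗ[F] V) (b.basis 0) = b.basis 0 := by
  have h := hu.2 (F ∙ b.basis 0) (Or.inl (Or.inr (Or.inl rfl))) _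
    (Submodule.mem_span_singleton_self _)
  -- The line `⟨v₁⟩` is an atom, so only `0` lies below it in the flag.
  have hbot : sSup {W' ∈ b.flag.full | W' < F ∙ b.basis 0} ≤ ⊥ :=
    sSup_le fun W' hW' => ((nonzero_span_atom _ (b.basis.ne_zero 0)).2 W' hW'.2).le
  exact sub_eq_zero.1 ((Submodule.mem_bot F).1 (hbot h))

/-- Conjugating a transvection by `u` moves its vector by `u`, and `U₀` fixes `v₁`. -/
lemma SymplecticBasis.transvection_mem_center (c : F) :
    (⟨siegel B (b.basis 0) (c • b.basis 0) (form_smul_self B _ _),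
      b.siegel_mem_U₀ (form_smul_self B _ _)⟩ : b.U₀) ∈ Subgroup.center b.U₀ := by
  rw [Subgroup.mem_center_iff]
  intro u
  apply Subtype.ext
  rw [Subgroup.coe_mul, Subgroup.coe_mul, ← mul_inv_eq_iff_eq_mul, conj_siegel]
  congr 1
  · exact b.apply_basis_zero u.2
  · rw [map_smul, b.apply_basis_zero u.2]

open scoped commutatorElement in
/-- The transvections along `v₁` are commutators in `U₀`. -/
lemma SymplecticBasis.exists_commutator_eq (c : F) : ∃ x y : b.U₀,
    siegel B (b.basis 0) (c • b.basis 0) (form_smul_self B _ _) = ((⁅x, y⁆ : b.U₀) : Sp B) := by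
  have g : ∀ i j, B.form (b.basis i) (b.basis j) =
    (!![0, 0, 0, 1; 0, 0, 1, 0; 0, -1, 0, 0; -1, 0, 0, 0] : Matrix (Fin 4) (Fin 4) F) i j := b.gram
  have h02 : B.form (b.basis 0) (b.basis 2) = 0 := by simp [g]
  have h01 : B.form (b.basis 0) (c • b.basis 1) = 0 := by simp [g]
  -- The Siegel element of `v₃` fixes `v₁` and sends `c v₂` to `c v₂ + c v₁`; conjugating by it the
  -- Siegel element of `c v₂` therefore multiplies that element by the transvection with parameter
  -- `c`.
  refine ⟨⟨_, b.siegel_mem_U₀ h02⟩, ⟨_, b.siegel_mem_U₀ h01⟩, ?_⟩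
  rw [commutatorElement_def, Subgroup.coe_mul, Subgroup.coe_mul, Subgroup.coe_mul,
    Subgroup.coe_inv, Subgroup.coe_inv, conj_siegel, eq_mul_inv_iff_mul_eq]
  apply Subtype.ext
  apply LinearEquiv.ext
  intro x
  have e0 : (siegel B (b.basis 0) (b.basis 2) h02 : V ≃ₗ[F] V) (b.basis 0) = b.basis 0 := by
    rw [siegel_apply]
    simp [g]
  have e1 : (siegel B (b.basis 0) (b.basis 2) h02 : V ≃ₗ[F] V) (c • b.basis 1)
      = c • b.basis 1 + c • b.basis 0 := by
    rw [siegel_apply]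
    simp [g]
  rw [Subgroup.coe_mul, LinearEquiv.mul_apply]
  simp only [siegel_apply, e0, e1, map_add, map_smul,
    smul_eq_mul, g]
  simp
  module

end UnipotentRadical

end ThetaTen

end

/-! ### The main theorem -/

open ThetaTen in
theorem mainTheorem3
    {F : Type*} [Field F] [Fintype F] (h2 : (2 : F) ≠ 0)
    {E : Type*} [Field E] [Algebra F E] [FiniteDimensional F E] (hE : Module.finrank F E = 2)
    {K : Type*} [Field K] [CharZero K] [IsAlgClosed K] {ψ : AddChar F K} (hψ : ψ ≠ 1)
    {V : Type*} [AddCommGroup V] [Module F V] [FiniteDimensional F V]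
    (hV : Module.finrank F V = 4) (B : SymplecticForm F V) (P : Polarization B) :
    -- `W₁⁻` is irreducible of dimension `q (q - 1) ^ 2 / 2`
    (W₁minusRep (E := E) h2 hE hψ P).IsIrreducible ∧
    (Module.finrank K (W₁minus (E := E) h2 hE hψ P) : ℚ)
      = (Fintype.card F : ℚ) * ((Fintype.card F : ℚ) - 1) ^ 2 / 2 ∧
    -- it is cuspidal and degenerate
    IsCuspidal (W₁minusRep (E := E) h2 hE hψ P) ∧
    IsDegenerate (W₁minusRep (E := E) h2 hE hψ P) ∧
    -- the center of a maximal unipotent subgroup `U₀` has no nonzero fixed vector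
    ∀ (b : SymplecticBasis B) (f : W₁minus (E := E) h2 hE hψ P),
      (∀ u ∈ Subgroup.center b.U₀, W₁minusRep (E := E) h2 hE hψ P u f = f) → f = 0 := by
  have hL : Module.finrank F P.L = 2 := by
    have h := P.finrank_add_finrank
    rw [← P.finrank_eq, hV] at h
    omega
  refine ⟨W₁minusRep_isIrreducible h2 hE hψ P hL, finrank_W₁minus h2 hE hψ P hL, ?_, ?_, ?_⟩
  · intro 𝓕 f hf
    obtain ⟨W₀, hW₀, hle⟩ := 𝓕.exists_least
    obtain ⟨v, hv, hv0⟩ := Submodule.exists_mem_ne_zero_of_ne_bot (𝓕.ne_bot W₀ hW₀)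
    refine eq_zero_of_transvections_fix h2 hE hψ P hL hv0 f fun c => hf _ ?_
    -- A transvection along `v` is the case `z = c v`, orthogonal to the first step because that
    -- step is isotropic.
    exact 𝓕.siegel_mem_unipotentRadical hW₀ hle hv fun w hw =>
      𝓕.isotropic W₀ hW₀ w hw _ (W₀.smul_mem c hv)
  · rintro ⟨b, ξ, -, f, hf0, hf⟩
    refine hf0 (eq_zero_of_transvections_fix h2 hE hψ P hL (b.basis.ne_zero 0) f fun c => ?_)
    -- A character with values in the commutative group `Kˣ` is trivial on commutators, so an
    -- eigenvector of `U₀` is fixed by the transvections along `v₁`.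
    obtain ⟨x, y, hxy⟩ := b.exists_commutator_eq c
    rw [hxy, hf, map_commutatorElement, commutatorElement_eq_one_iff_mul_comm.2 (mul_comm _ _),
      Units.val_one, one_smul]
  · intro b f hf
    refine eq_zero_of_transvections_fix h2 hE hψ P hL (b.basis.ne_zero 0) f fun c => ?_
    have h := hf _ (b.transvection_mem_center c)
    exact h
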